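/- Let $\ell\ge k\ge r\ge 2$ be integers. An $r$-graph $\mathcal H$ is a collection of $r$-subsets (edges) of a finite vertex set $V(\mathcal H)$; $v(\mathcal H)=|V(\mathcal H)|$, and $\mathcal H-x$ is $\mathcal H$ with the vertex $x$ and all edges containing $x$ removed. A homomorphism $\phi:Q\to\mathcal H$ is a map $V(Q)\to V(\mathcal H)$ sending every edge of $Q$ to an edge of $\mathcal H$. Let $K_m^r$ be the complete $r$-graph on $[m]$, let $\mathfrak K_\ell^r$ be the class of $r$-graphs that admit a homomorphism to $K_\ell^r$ (the $\ell$-partite $r$-graphs, empty parts allowed), and let $\chi(Q)$ be the least $m$ such that $Q$ admits a homomorphism to $K_m^r$. For a graph $F$, the expansion $H_F^r$ is the $r$-graph obtained by adding $r-2$ new vertices to each edge of $F$, the added sets being pairwise disjoint. A graph $F$ is edge-critical if $\chi(F\setminus\{e\})<\chi(F)$ for some edge $e$ of $F$. An $r$-graph is $P$-free if it does not contain $P$ as a (not necessarily induced) subgraph. Write $\mathrm{inj}(Q,\mathcal H)$ for the number of injective homomorphisms $Q\to\mathcal H$, and $\mathrm{inj}(n,Q,P)$ for the maximum of $\mathrm{inj}(Q,\mathcal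 H)$ over all $P$-free $r$-graphs $\mathcal H$ on $n$ vertices; put $\pi_{\mathrm{inj}}(Q,P)=\lim_{n\to\infty}\mathrm{inj}(n,Q,P)/n^{v(Q)}$. The $Q$-degree of $x\in V(\mathcal H)$ is the number of injective homomorphisms $\phi:Q\to\mathcal H$ with $x\in\phi(V(Q))$, and $\delta_Q(\mathcal H)$ is the minimum $Q$-degree. The $Q$-Lagrangian of an $r$-graph $\mathcal G$ on $[m]$ is $$\lambda_Q(\mathcal G)=\max\Big\{\sum_{\phi}\ \prod_{q\in V(Q)}x_{\phi(q)}\ :\ x_1,\dots,x_m\ge 0,\ x_1+\dots+x_m=1\Big\},$$ the sum being over all homomorphisms $\phi:Q\to\mathcal G$. An $r$-graph $P$ is $Q$-vertex-extendable with respect to a class $\mathfrak H$ of $r$-graphs if there exist $\varepsilon>0$ and $N_0$ such that every $P$-free $r$-graph $\mathcal H$ on $n\ge N_0$ vertices with $\delta_Q(\mathcal H)\ge(1-\varepsilon)\frac{v(Q)\,\mathrm{inj}(n,Q,P)}{n}$ and $\mathcal H-x\in\mathfrak H$ for some $x\in V(\mathcal H)$ satisfies $\mathcal H\in\mathfrak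 H$. **Proposition.** Let $Q$ be an $r$-graph with $\chi(Q)=k$ and let $F$ be an edge-critical (finite) graph with $\chi(F)=\ell+1$. There exist $\varepsilon>0$ and $N_0$ such that the following holds for all $n\ge N_0$: if $\mathcal H$ is an $n$-vertex $H_F^r$-free $r$-graph with $$\delta_Q(\mathcal H)\ \ge\ \big(\lambda_Q(K_\ell^r)-\varepsilon\big)\,v(Q)\,n^{v(Q)-1}$$ and $x\in V(\mathcal H)$ is a vertex with $\mathcal H-x\in\mathfrak K_\ell^r$, then $\mathcal H\in\mathfrak K_\ell^r$. In particular, if $\pi_{\mathrm{inj}}(Q,H_F^r)=\lambda_Q(K_\ell^r)$, then $H_F^r$ is $Q$-vertex-extendable with respect to $\mathfrak K_\ell^r$. -/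

import Mathlib

open Filter Topology

universe u v w

noncomputable section

/-- An `r`-uniform hypergraph on the vertex type `V`: a collection of `r`-element subsets. -/
@[ext] structure RGraph (r : ℕ) (V : Type u) where
  edges : Set (Finset V)
  uniform : ∀ e ∈ edges, e.card = r

namespace RGraph

variable {r : ℕ} {U : Type u} {V : Type v} {W : Type w}

/-- The complete `r`-graph `K_ℓ^r` on `ℓ` vertices. -/
def complete (r ℓ : ℕ) : RGraph r (Fin ℓ) where
  edges := {e | e.card = r}
  uniform := fun _ he => he

/-- `φ` is a homomorphism from `Q` to `H`: the image of every edge is an edge. -/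
def IsHom [DecidableEq W] (Q : RGraph r V) (H : RGraph r W) (φ : V → W) : Prop :=
  ∀ e ∈ Q.edges, e.image φ ∈ H.edges

/-- `Q` is `K_ℓ^r`-colorable (equivalently, `ℓ`-partite, empty parts being allowed):
membership in the class of all `K_ℓ^r`-colorable `r`-graphs. -/
def IsPartite (ℓ : ℕ) (Q : RGraph r V) : Prop :=
  ∃ φ : V → Fin ℓ, Q.IsHom (complete r ℓ) φ

/-- The chromatic number of a (finite) `r`-graph: the least `ℓ` such that it is
`K_ℓ^r`-colorable. -/
def chromaticNumber (Q : RGraph r V) : ℕ :=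
  sInf {ℓ : ℕ | Q.IsPartite ℓ}

/-- The injective homomorphisms from `Q` to `H`. -/
def Inj (Q : RGraph r V) (H : RGraph r W) : Set (V ↪ W) :=
  {f | ∀ e ∈ Q.edges, e.map f ∈ H.edges}

/-- `inj(Q, H)`, the number of injective homomorphisms from `Q` to `H`. -/
def inj (Q : RGraph r V) (H : RGraph r W) : ℕ := (Q.Inj H).ncard

/-- The `Q`-degree of `x` in `H`: the number of injective homomorphisms from `Q` to `H`
whose image contains `x`. -/
def qDegree (Q : RGraph r V) (H : RGraph r W) (x : W) : ℕ :=
  {f | f ∈ Q.Inj H ∧ x ∈ Set.range f}.ncard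

/-- The minimum `Q`-degree of `H`. -/
def minQDegree (Q : RGraph r V) (H : RGraph r W) : ℕ := ⨅ x : W, Q.qDegree H x

/-- `H` is `P`-free: it has no (not necessarily induced) subgraph that is a copy of `P`. -/
def Free (P : RGraph r V) (H : RGraph r W) : Prop := P.Inj H = ∅

/-- `H - x`: the vertex `x` and all edges containing it are removed. -/
def deleteVertex (H : RGraph r V) (x : V) : RGraph r {y : V // y ≠ x} where
  edges := {e | e.map (Function.Embedding.subtype _) ∈ H.edges}
  uniform := fun e he => by simpa using H.uniform _ he

/-- `inj(n, Q, P)`: the maximum of `inj(Q, H)` over all `P`-free `r`-graphs `H` on `n` vertices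
(a bounded set of natural numbers when the vertex set of `Q` is finite). -/
def injMax (n : ℕ) (Q : RGraph r V) (P : RGraph r W) : ℕ :=
  sSup {m : ℕ | ∃ H : RGraph r (Fin n), P.Free H ∧ m = Q.inj H}

/-- `π_inj(Q, P) = a`, that is, `inj(n, Q, P) / n ^ v(Q)` tends to `a`. -/
def HasInjDensity [Fintype V] (Q : RGraph r V) (P : RGraph r W) (a : ℝ) : Prop :=
  Tendsto (fun n : ℕ => (injMax n Q P : ℝ) / (n : ℝ) ^ Fintype.card V) atTop (𝓝 a)

open Classical in
/-- The `Q`-Lagrange polynomial of `H`: the sum over all homomorphisms `φ` from `Q` to `H` of the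
monomial `∏ X_{φ(q)}`, `q` ranging over the vertices of `Q` (homogeneous of degree `v(Q)`). -/
def lagrangePoly [Fintype V] [Fintype W] [DecidableEq W] (Q : RGraph r V) (H : RGraph r W)
    (x : W → ℝ) : ℝ :=
  ∑ φ : V → W with Q.IsHom H φ, ∏ q : V, x (φ q)

/-- The `Q`-Lagrangian `λ_Q(H)`: the maximum of the `Q`-Lagrange polynomial of `H` over the
standard simplex. -/
def lagrangian [Fintype V] [Fintype W] [DecidableEq W] (Q : RGraph r V) (H : RGraph r W) : ℝ :=
  sSup (Q.lagrangePoly H '' stdSimplex ℝ W)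

/-- The expansion `H_F^r` of a graph `F`: every edge `e` of `F` is enlarged by the `r - 2` new
vertices `(e, i)`, `i < r - 2`. -/
def expansion (hr : 2 ≤ r) (F : SimpleGraph V) : RGraph r (V ⊕ (F.edgeSet × Fin (r - 2))) where
  edges := {E | ∃ e : F.edgeSet,
    (E : Set (V ⊕ (F.edgeSet × Fin (r - 2)))) =
      Sum.inl '' {x : V | x ∈ (e : Sym2 V)} ∪ Sum.inr '' {p | p.1 = e}}
  uniform := by
    classical
    rintro E ⟨⟨e, he⟩, hE⟩
    induction e using Sym2.ind with
    | _ a b =>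
      have hab : a ≠ b := F.ne_of_adj he
      have h : E = ({a, b} : Finset V).disjSum
          ((Finset.univ : Finset (Fin (r - 2))).map
            ⟨fun i => ((⟨s(a, b), he⟩ : F.edgeSet), i), fun i j h => by simpa using h⟩) := by
        apply Finset.coe_injective
        rw [hE]
        ext x
        rcases x with x | ⟨e', i⟩
        · simp
        · simp [eq_comm]
          exact ⟨fun h => ⟨i, by subst h; rfl⟩, fun ⟨j, h⟩ => congrArg Prod.fst h⟩
      rw [h, Finset.card_disjSum, Finset.card_pair hab]
      simp
      omega

/-- `P` is `Q`-vertex-extendable with respect to the class `𝔥` of `r`-graphs: for some `ε > 0`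
and `N₀`, every `P`-free `r`-graph `H` on `n ≥ N₀` vertices whose minimum `Q`-degree is at least
`(1 - ε) v(Q) inj(n, Q, P) / n` and such that `H - x ∈ 𝔥` for some vertex `x` lies in `𝔥`. -/
def VertexExtendable [Fintype V] (Q : RGraph r V) (P : RGraph r W)
    (𝔥 : ∀ {X : Type u}, RGraph r X → Prop) : Prop :=
  ∃ ε : ℝ, 0 < ε ∧ ∃ N₀ : ℕ, ∀ (X : Type u) [Fintype X], N₀ ≤ Fintype.card X →
    ∀ H : RGraph r X, P.Free H →
      (1 - ε) * (Fintype.card V * injMax (Fintype.card X) Q P / Fintype.card X : ℝ)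
        ≤ (Q.minQDegree H : ℝ) →
      (∃ x : X, 𝔥 (H.deleteVertex x)) → 𝔥 H

end RGraph

/-- A graph is edge-critical if removing some edge decreases its chromatic number. -/
def EdgeCritical {V : Type u} (F : SimpleGraph V) : Prop :=
  ∃ e ∈ F.edgeSet, (F.deleteEdges {e}).chromaticNumber < F.chromaticNumber

end

/-! Colour `H - x` with `ℓ` colours and give `x` an arbitrary colour. For `y ≠ x`, all but a
lower-order number of injective homomorphisms through `y` avoid `x`, so composing them with the
colouring gives homomorphisms `Q → K_ℓ^r`. Hence the `Q`-degree of `y` is, up to lower order, at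
most the partial derivative of the Lagrange polynomial in the direction of the colour of `y`, taken
at the vector of class sizes. By Euler's identity these derivatives sum over the vertices to `v(Q)`
times the polynomial, so the degree hypothesis makes the class sizes a near-maximizer. A maximizer
has no zero coordinate, since splitting a class in two creates new homomorphisms; by compactness all
classes have linear size (`exists_coord_ge_of_near_lagrangian`). All derivatives are then close to
their average (`classSize_ge_and_lagrangeDeriv_le`).

Call a pair good if no small vertex set blocks all the edges through it. Non-good pairs contribute
few homomorphisms, so a vertex `y ≠ x` with many non-good partners in another class would have too
small a degree (`qDegree_add_missing_le_of_exceptional`). Conversely, good pairs extend greedily to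
disjoint edges, so an embedded graph with good edges yields its expansion.

Edge-criticality gives an edge `ab` of `F` and an `ℓ`-colouring of `F - ab` with `a`, `b` of equal
colour. An edge of `H` with two equally coloured vertices, both having few missing neighbours, can
host `ab`, and the rest of `F` is placed greedily in the classes (`not_free_expansion_of_edge`). So
no colour repeats in an edge of `H` outside `x`. If `x` had many good neighbours in every class, the
same construction would work with `a` at `x` and `b` at one of them. Thus some class contains few;
recolour `x` with that class. The degree of `x` then forces few missing neighbours in the other
classes, and the construction rules out a repeated colour in any edge (`exists_eps_isPartite`). -/

namespace RGraph

/-! ### Good pairs and copies of the expansion -/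

open Classical in
/-- The pairs of distinct vertices of `H` lying in an edge that avoids any prescribed set of at
most `M` other vertices. -/
def goodGraph {r : ℕ} {V : Type u} (H : RGraph r V) (M : ℕ) : SimpleGraph V where
  Adj y z := y ≠ z ∧ ∀ S : Finset V, S.card ≤ M → y ∉ S → z ∉ S →
    ∃ E ∈ H.edges, y ∈ E ∧ z ∈ E ∧ Disjoint E S
  symm := ⟨fun _ _ h => ⟨h.1.symm, fun S hS hz hy => by
    obtain ⟨E, hE, h1, h2, h3⟩ := h.2 S hS hy hz
    exact ⟨E, hE, h2, h1, h3⟩⟩⟩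
  loopless := ⟨fun _ h => h.1 rfl⟩

section Expansion

variable {r : ℕ} {V : Type u} {VF : Type w}

open Classical in
/-- Pairwise disjoint enlargements of the edges of an embedded graph give a copy of its
expansion. -/
theorem not_free_expansion_of_edges (hr : 2 ≤ r) [Fintype VF] (F : SimpleGraph VF)
    (H : RGraph r V) (f : VF → V) (hf : Function.Injective f) (A : F.edgeSet → Finset V)
    (hA : ∀ e, A e ∈ H.edges) (hmem : ∀ e v, f v ∈ A e ↔ v ∈ (e : Sym2 VF))
    (hdisj : ∀ e e', e ≠ e' → ∀ z ∈ A e, z ∈ A e' → z ∈ Set.range f) :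
    ¬ (expansion hr F).Free H := by
  -- Exactly two vertices of `A e` are embedded vertices of `F`; the remaining `r - 2` serve as the
  -- new vertices of the expansion.
  have hcard : ∀ e : F.edgeSet, ((A e).filter (fun z => z ∉ Set.range f)).card = r - 2 := by
    rintro ⟨e, he⟩
    induction e using Sym2.ind with
    | _ a b =>
      have hab : a ≠ b := F.ne_of_adj he
      have h1 : (A ⟨s(a, b), he⟩).filter (fun z => z ∈ Set.range f) = {f a, f b} := by
        ext z
        simp only [Finset.mem_filter, Finset.mem_insert, Finset.mem_singleton]
        constructor
        · rintro ⟨hz, v, rfl⟩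
          have := (hmem _ v).1 hz
          simp only [Sym2.mem_iff] at this
          rcases this with rfl | rfl <;> simp
        · rintro (rfl | rfl)
          · exact ⟨(hmem _ a).2 (by simp), a, rfl⟩
          · exact ⟨(hmem _ b).2 (by simp), b, rfl⟩
      have h2 := Finset.card_filter_add_card_filter_not (s := A ⟨s(a, b), he⟩)
        (fun z => z ∈ Set.range f)
      rw [h1, Finset.card_pair (hf.ne hab), H.uniform _ (hA _)] at h2
      omega
  let t : ∀ e : F.edgeSet, Fin (r - 2) → V := fun e i =>
    ((Finset.equivFinOfCardEq (hcard e)).symm i : V)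
  have ht : ∀ e i, t e i ∈ A e ∧ t e i ∉ Set.range f := fun e i =>
    Finset.mem_filter.1 ((Finset.equivFinOfCardEq (hcard e)).symm i).2
  have hti : ∀ e, Function.Injective (t e) := fun e i j h =>
    (Finset.equivFinOfCardEq (hcard e)).symm.injective (Subtype.ext h)
  let g : VF ⊕ (F.edgeSet × Fin (r - 2)) → V := Sum.elim f (fun p => t p.1 p.2)
  have hg : Function.Injective g := by
    refine Function.Injective.sumElim hf ?_ ?_
    · rintro ⟨e, i⟩ ⟨e', j⟩ h
      have h : t e i = t e' j := h
      by_cases hee : e = e'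
      · subst hee
        rw [hti e h]
      · exact absurd (hdisj e e' hee (t e i) (ht e i).1 (h ▸ (ht e' j).1)) (ht e i).2
    · rintro a ⟨e, i⟩ h
      exact (ht e i).2 ⟨a, h⟩
  intro hfree
  have : (⟨g, hg⟩ : _ ↪ V) ∈ (expansion hr F).Inj H := by
    intro E hE
    obtain ⟨e, he⟩ := id hE
    have hsub : E.map ⟨g, hg⟩ ⊆ A e := by
      intro z hz
      obtain ⟨p, hp, rfl⟩ := Finset.mem_map.1 hz
      have hp' : p ∈ (E : Set _) := hp
      rw [he] at hp'
      rcases hp' with ⟨v, hv, rfl⟩ | ⟨⟨e', i⟩, hv, rfl⟩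
      · exact (hmem e v).2 hv
      · have hv : e' = e := hv
        subst hv
        exact (ht e' i).1
    rw [Finset.eq_of_subset_of_card_le hsub
      (by rw [Finset.card_map, H.uniform _ (hA e), (expansion hr F).uniform E hE])]
    exact hA e
  rw [Free] at hfree
  rw [hfree] at this
  exact this

open Classical in
/-- An embedded graph all of whose edges but one are good, the remaining one being contained in an
edge of `H` that meets the embedded vertex set in nothing else, extends to a copy of the
expansion. -/
theorem not_free_expansion_of_goodGraph (hr : 2 ≤ r) [Fintype VF] (F : SimpleGraph VF)
    (H : RGraph r V) {M : ℕ} (hM : Fintype.card VF + (Fintype.card F.edgeSet + 1) * r ≤ M)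
    (f : VF → V) (hf : Function.Injective f) (e₀ : F.edgeSet) (E₀ : Finset V)
    (hE₀ : E₀ ∈ H.edges) (hmem₀ : ∀ v, f v ∈ E₀ ↔ v ∈ (e₀ : Sym2 VF))
    (hgood : ∀ a b, F.Adj a b → s(a, b) ≠ (e₀ : Sym2 VF) → (H.goodGraph M).Adj (f a) (f b)) :
    ¬ (expansion hr F).Free H := by
  -- Edges are chosen one at a time, with `e₀` always among those already treated. Values of `A`
  -- outside `insert e₀ s` are placeholders.
  have key : ∀ s : Finset F.edgeSet, ∃ A : F.edgeSet → Finset V, (∀ e, A e ∈ H.edges) ∧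
      (∀ e ∈ insert e₀ s, ∀ v, f v ∈ A e ↔ v ∈ (e : Sym2 VF)) ∧
      (∀ e ∈ insert e₀ s, ∀ e' ∈ insert e₀ s, e ≠ e' → ∀ z ∈ A e, z ∈ A e' →
        z ∈ Set.range f) := by
    intro s
    induction s using Finset.induction_on with
    | empty =>
      refine ⟨fun _ => E₀, fun _ => hE₀, ?_, ?_⟩
      · intro e he
        simp only [insert_empty_eq, Finset.mem_singleton] at he
        subst he
        exact hmem₀
      · intro e he e' he' hne
        simp only [insert_empty_eq, Finset.mem_singleton] at he he'
        exact absurd (he.trans he'.symm) hne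
    | insert e s hes ih =>
      obtain ⟨A, hA, hm, hd⟩ := ih
      by_cases he0 : e = e₀
      · subst he0
        refine ⟨A, hA, ?_, ?_⟩
        · simpa using hm
        · simpa using hd
      obtain ⟨E, hE, hEm, hEd⟩ : ∃ E ∈ H.edges, (∀ v, f v ∈ E ↔ v ∈ (e : Sym2 VF)) ∧
          ∀ e' ∈ insert e₀ s, ∀ z ∈ E, z ∈ A e' → z ∈ Set.range f := by
        obtain ⟨e, he⟩ := e
        induction e using Sym2.ind with
        | _ a b =>
          have hadj := hgood a b he (fun h => he0 (Subtype.ext h))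
          -- The new edge must avoid all embedded vertices and all earlier edges except its own two
          -- ends; `M` is large enough to forbid all of these at once.
          set S : Finset V := ((Finset.univ.image f ∪ (insert e₀ s).biUnion A).erase
            (f a)).erase (f b) with hS
          have hScard : S.card ≤ M := by
            refine le_trans ?_ hM
            refine (Finset.card_le_card ((Finset.erase_subset _ _).trans
              (Finset.erase_subset _ _))).trans ((Finset.card_union_le _ _).trans
                (add_le_add Finset.card_image_le ?_))
            refine (Finset.card_biUnion_le_card_mul _ _ r
              (fun e _ => (H.uniform _ (hA e)).le)).trans (Nat.mul_le_mul_right _ ?_)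
            exact (Finset.card_le_univ _).trans (Nat.le_succ _)
          obtain ⟨E, hE, haE, hbE, hdis⟩ := hadj.2 S hScard (by simp [hS]) (by simp [hS])
          have hout : ∀ z ∈ E, z ∈ Finset.univ.image f ∪ (insert e₀ s).biUnion A →
              z = f a ∨ z = f b := by
            intro z hz hz'
            by_contra! hne
            exact Finset.disjoint_left.1 hdis hz
              (Finset.mem_erase.2 ⟨hne.2, Finset.mem_erase.2 ⟨hne.1, hz'⟩⟩)
          refine ⟨E, hE, fun v => ?_, fun e' he' z hz hz' => ?_⟩
          · simp only [Sym2.mem_iff]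
            constructor
            · intro hv
              rcases hout _ hv (by simp) with h | h
              · exact Or.inl (hf h)
              · exact Or.inr (hf h)
            · rintro (rfl | rfl) <;> assumption
          · rcases hout z hz (Finset.mem_union_right _ (Finset.mem_biUnion.2 ⟨e', he', hz'⟩))
              with rfl | rfl <;> simp
      have hes' : e ∉ insert e₀ s := by simp [he0, hes]
      have hupd : ∀ e' ∈ insert e₀ s, Function.update A e E e' = A e' := fun e' he' =>
        Function.update_of_ne (by rintro rfl; exact hes' he') _ _
      have hins : ∀ e', e' ∈ insert e₀ (insert e s) → e' = e ∨ e' ∈ insert e₀ s := by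
        intro e' he'
        simp only [Finset.mem_insert] at he' ⊢
        tauto
      refine ⟨Function.update A e E, ?_, ?_, ?_⟩
      · intro e'
        by_cases h : e' = e
        · subst h; simpa using hE
        · rw [Function.update_of_ne h]; exact hA e'
      · intro e' he'
        rcases hins e' he' with rfl | he'
        · simpa using hEm
        · rw [hupd e' he']; exact hm e' he'
      · intro e₁ he₁ e₂ he₂ hne z hz₁ hz₂
        rcases hins e₁ he₁ with rfl | h₁ <;> rcases hins e₂ he₂ with rfl | h₂
        · exact absurd rfl hne
        · rw [Function.update_self] at hz₁
          rw [hupd e₂ h₂] at hz₂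
          exact hEd e₂ h₂ z hz₁ hz₂
        · rw [Function.update_self] at hz₂
          rw [hupd e₁ h₁] at hz₁
          exact hEd e₁ h₁ z hz₂ hz₁
        · rw [hupd e₁ h₁] at hz₁
          rw [hupd e₂ h₂] at hz₂
          exact hd e₁ h₁ e₂ h₂ hne z hz₁ hz₂
  obtain ⟨A, hA, hm, hd⟩ := key Finset.univ
  exact not_free_expansion_of_edges hr F H f hf A hA (fun e => hm e (by simp))
    (fun e e' => hd e (by simp) e' (by simp))

end Expansion

end RGraph

/-! ### Greedy embedding and edge-critical graphs -/

open Classical in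
/-- Greedy choice of a system of distinct representatives whose differently coloured members are
adjacent. -/
theorem SimpleGraph.exists_greedy_embedding {V : Type u} [Fintype V] {VF : Type w} {ℓ : ℕ}
    (G : SimpleGraph V) (c : V → Fin ℓ) (col : VF → Fin ℓ) (C : VF → Finset V) (D T : ℝ)
    (hC : ∀ v, ∀ z ∈ C v, c z = col v)
    (hmiss : ∀ v, ∀ z ∈ C v, ∀ j, j ≠ c z →
      ((Finset.univ.filter fun u => c u = j ∧ ¬ G.Adj z u).card : ℝ) ≤ D)
    (hD : 0 ≤ D) (f₀ : VF → V) (s : Finset VF) (hcard : ∀ v ∈ s, T ≤ (C v).card)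
    (hT : s.card * (D + 1) < T) :
    ∃ f : VF → V, (∀ v ∉ s, f v = f₀ v) ∧ (∀ v ∈ s, f v ∈ C v) ∧ Set.InjOn f s ∧
      ∀ a ∈ s, ∀ b ∈ s, col a ≠ col b → G.Adj (f a) (f b) := by
  induction s using Finset.induction_on with
  | empty => exact ⟨f₀, by simp, by simp, by simp, by simp⟩
  | insert v s hv ih =>
    rw [Finset.card_insert_of_notMem hv] at hT
    push_cast at hT
    obtain ⟨f, hf0, hfC, hinj, hadj⟩ := ih (fun v hv => hcard v (Finset.mem_insert_of_mem hv))
      (by nlinarith)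
    -- Each vertex already placed excludes itself and at most `D` non-neighbours of the required
    -- colour, hence the factor `D + 1`.
    obtain ⟨z, hzC, hz⟩ : ∃ z ∈ C v, z ∉ s.biUnion fun a =>
        insert (f a) (if col a = col v then ∅ else
          Finset.univ.filter fun u => c u = col v ∧ ¬ G.Adj (f a) u) := by
      apply Finset.exists_mem_notMem_of_card_lt_card
      have h1 : ((s.biUnion fun a => insert (f a) (if col a = col v then ∅ else
          Finset.univ.filter fun u => c u = col v ∧ ¬ G.Adj (f a) u)).card : ℝ)
          ≤ ∑ a ∈ s, (D + 1) := by
        refine (Nat.cast_le.2 Finset.card_biUnion_le).trans ?_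
        push_cast
        refine Finset.sum_le_sum fun a ha => ?_
        refine (Nat.cast_le.2 (Finset.card_insert_le _ _)).trans ?_
        push_cast
        gcongr
        split_ifs with h
        · simpa using hD
        · exact hmiss a _ (hfC a ha) _ (by rw [hC a _ (hfC a ha)]; exact Ne.symm h)
      rw [Finset.sum_const, nsmul_eq_mul] at h1
      have h2 := hcard v (Finset.mem_insert_self _ _)
      have : ((s.biUnion fun a => insert (f a) (if col a = col v then ∅ else
          Finset.univ.filter fun u => c u = col v ∧ ¬ G.Adj (f a) u)).card : ℝ)
          < (C v).card := by nlinarith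
      exact_mod_cast this
    have hz1 : ∀ a ∈ s, z ≠ f a := fun a ha h => hz (Finset.mem_biUnion.2 ⟨a, ha, by simp [h]⟩)
    have hz2 : ∀ a ∈ s, col a ≠ col v → G.Adj (f a) z := by
      intro a ha hne
      by_contra hna
      exact hz (Finset.mem_biUnion.2 ⟨a, ha, by simp [hne, hna, hC v z hzC]⟩)
    have hne : ∀ a ∈ s, a ≠ v := fun a ha h => hv (h ▸ ha)
    refine ⟨Function.update f v z, ?_, ?_, ?_, ?_⟩
    · intro u hu
      simp only [Finset.mem_insert, not_or] at hu
      rw [Function.update_of_ne hu.1, hf0 u hu.2]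
    · intro u hu
      rcases Finset.mem_insert.1 hu with rfl | hu
      · simpa using hzC
      · rw [Function.update_of_ne (hne u hu)]; exact hfC u hu
    · intro a ha b hb hab
      rcases Finset.mem_insert.1 ha with rfl | ha' <;> rcases Finset.mem_insert.1 hb with rfl | hb'
      · rfl
      · rw [Function.update_self, Function.update_of_ne (hne b hb')] at hab
        exact absurd hab (hz1 b hb')
      · rw [Function.update_self, Function.update_of_ne (hne a ha')] at hab
        exact absurd hab.symm (hz1 a ha')
      · rw [Function.update_of_ne (hne a ha'), Function.update_of_ne (hne b hb')] at hab
        exact hinj ha' hb' hab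
    · intro a ha b hb hab
      rcases Finset.mem_insert.1 ha with rfl | ha' <;> rcases Finset.mem_insert.1 hb with rfl | hb'
      · exact absurd rfl hab
      · rw [Function.update_self, Function.update_of_ne (hne b hb')]
        exact (hz2 b hb' hab.symm).symm
      · rw [Function.update_self, Function.update_of_ne (hne a ha')]
        exact hz2 a ha' hab
      · rw [Function.update_of_ne (hne a ha'), Function.update_of_ne (hne b hb')]
        exact hadj a ha' b hb' hab

/-- An edge-critical graph of chromatic number `ℓ + 1` has an edge whose removal leaves a graph
with an `ℓ`-colouring giving both its ends a prescribed colour. -/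
theorem EdgeCritical.exists_coloring {VF : Type w} {F : SimpleGraph VF} (hF : EdgeCritical F)
    {ℓ : ℕ} (hχ : F.chromaticNumber = ((ℓ + 1 : ℕ) : ℕ∞)) (i : Fin ℓ) :
    ∃ a b, F.Adj a b ∧ ∃ col : VF → Fin ℓ, col a = i ∧ col b = i ∧
      ∀ u v, F.Adj u v → s(u, v) ≠ s(a, b) → col u ≠ col v := by
  obtain ⟨e, he, hlt⟩ := hF
  induction e using Sym2.ind with
  | _ a b =>
    rw [hχ] at hlt
    have hcol : (F.deleteEdges {s(a, b)}).Colorable ℓ := by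
      rw [← SimpleGraph.chromaticNumber_le_iff_colorable]
      exact Order.le_of_lt_add_one (by simpa using hlt)
    obtain ⟨C⟩ := hcol
    have hC : ∀ u v, F.Adj u v → s(u, v) ≠ s(a, b) → C u ≠ C v := fun u v huv hne =>
      C.valid (by simp [SimpleGraph.deleteEdges_adj, huv] at hne ⊢; simpa using hne)
    -- If the ends had different colours, `C` would properly colour all of `F` with `ℓ` colours.
    have hab : C a = C b := by
      by_contra hne
      have : F.Colorable ℓ := ⟨SimpleGraph.Coloring.mk C (fun {u v} huv => by
        by_cases h : s(u, v) = s(a, b)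
        · rcases Sym2.eq_iff.1 h with ⟨rfl, rfl⟩ | ⟨rfl, rfl⟩
          · exact hne
          · exact Ne.symm hne
        · exact hC u v huv h)⟩
      have h2 := this.chromaticNumber_le
      rw [hχ] at h2
      exact absurd (Nat.cast_le.1 h2) (by omega)
    refine ⟨a, b, he, fun v => Equiv.swap (C a) i (C v), by simp, by simp [← hab], ?_⟩
    intro u v huv hne h
    exact hC u v huv hne ((Equiv.swap (C a) i).injective h)

namespace RGraph

open Classical in
/-- An edge of `H` with two vertices of the same colour whose good neighbourhoods share many
vertices in every other colour class yields a copy of the expansion of an edge-critical graph. -/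
theorem not_free_expansion_of_edge {r ℓ : ℕ} (hr : 2 ≤ r) {V : Type u} [Fintype V]
    {VF : Type w} [Fintype VF] {F : SimpleGraph VF} (hF : EdgeCritical F)
    (hχ : F.chromaticNumber = ((ℓ + 1 : ℕ) : ℕ∞)) (H : RGraph r V) {M : ℕ}
    (hM : Fintype.card VF + (Fintype.card F.edgeSet + 1) * r ≤ M) (c : V → Fin ℓ) (D T : ℝ)
    (hD : 0 ≤ D) (hT : Fintype.card VF * (D + 1) + r < T) (E₀ : Finset V) (hE₀ : E₀ ∈ H.edges)
    {y y' : V} (hy : y ∈ E₀) (hy' : y' ∈ E₀) (hyy' : y ≠ y') (i : Fin ℓ)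
    (hmiss : ∀ z ∉ E₀, ∀ j, j ≠ c z →
      ((Finset.univ.filter fun u => c u = j ∧ ¬ (H.goodGraph M).Adj z u).card : ℝ) ≤ D)
    (hi : T ≤ ((Finset.univ.filter fun u => c u = i).card : ℝ))
    (hj : ∀ j, j ≠ i → T ≤ ((Finset.univ.filter fun u => c u = j ∧
      (H.goodGraph M).Adj y u ∧ (H.goodGraph M).Adj y' u).card : ℝ)) :
    ¬ (expansion hr F).Free H := by
  obtain ⟨a, b, hab, col, ha, hb, hcol⟩ := hF.exists_coloring hχ i
  have hne : a ≠ b := F.ne_of_adj hab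
  -- A vertex of colour `i` is joined to `a` or `b` by no edge other than `ab`, so it needs no
  -- adjacency to `y` or `y'`. Removing `E₀` costs at most `r` candidates and ensures that `E₀`
  -- meets the embedding only in `y` and `y'`.
  let C : VF → Finset V := fun v => (if col v = i then Finset.univ.filter fun u => c u = i else
    Finset.univ.filter fun u => c u = col v ∧
      (H.goodGraph M).Adj y u ∧ (H.goodGraph M).Adj y' u) \ E₀
  have hC1 : ∀ v, ∀ z ∈ C v, c z = col v := by
    intro v z hz
    have hz := (Finset.mem_sdiff.1 hz).1
    split_ifs at hz with h
    · rw [h]; exact (Finset.mem_filter.1 hz).2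
    · exact (Finset.mem_filter.1 hz).2.1
  have hC2 : ∀ v, ∀ z ∈ C v, z ∉ E₀ := fun v z hz => (Finset.mem_sdiff.1 hz).2
  have hC3 : ∀ v, col v ≠ i → ∀ z ∈ C v, (H.goodGraph M).Adj y z ∧ (H.goodGraph M).Adj y' z := by
    intro v hv z hz
    have hz := (Finset.mem_sdiff.1 hz).1
    rw [if_neg hv] at hz
    exact (Finset.mem_filter.1 hz).2.2
  have hC4 : ∀ v, T - r ≤ ((C v).card : ℝ) := by
    intro v
    have h1 : T ≤ ((if col v = i then Finset.univ.filter fun u => c u = i else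
        Finset.univ.filter fun u => c u = col v ∧
          (H.goodGraph M).Adj y u ∧ (H.goodGraph M).Adj y' u : Finset V).card : ℝ) := by
      split_ifs with h
      · exact hi
      · exact hj _ h
    have h2 := Finset.le_card_sdiff E₀ (if col v = i then Finset.univ.filter fun u => c u = i else
        Finset.univ.filter fun u => c u = col v ∧
          (H.goodGraph M).Adj y u ∧ (H.goodGraph M).Adj y' u : Finset V)
    rw [H.uniform _ hE₀, tsub_le_iff_right] at h2
    have h3 := (Nat.cast_le (α := ℝ)).2 h2
    push_cast at h3
    linarith
  let f₀ : VF → V := fun v => if v = a then y else y'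
  let s : Finset VF := (Finset.univ.erase a).erase b
  have hs : ∀ v, v ∉ s ↔ v = a ∨ v = b := by
    intro v
    simp [s]
    tauto
  obtain ⟨f, hf0, hfC, hinj, hadj⟩ := (H.goodGraph M).exists_greedy_embedding c col C D (T - r)
    hC1 (fun v z hz => hmiss z (hC2 v z hz)) hD f₀ s (fun v _ => hC4 v) (by
      have : (s.card : ℝ) ≤ Fintype.card VF := Nat.cast_le.2 (Finset.card_le_univ s)
      nlinarith)
  have hfa : f a = y := by rw [hf0 a ((hs a).2 (Or.inl rfl))]; simp [f₀]
  have hfb : f b = y' := by rw [hf0 b ((hs b).2 (Or.inr rfl))]; simp [f₀, hne.symm]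
  have hmem₀ : ∀ v, f v ∈ E₀ ↔ v ∈ s(a, b) := by
    intro v
    rw [Sym2.mem_iff, ← hs]
    constructor
    · exact fun h hv => hC2 v _ (hfC v hv) h
    · intro h
      rcases (hs v).1 h with rfl | rfl
      · rwa [hfa]
      · rwa [hfb]
  have hfinj : Function.Injective f := by
    intro u v huv
    by_cases hu : u ∈ s <;> by_cases hv : v ∈ s
    · exact hinj hu hv huv
    · exact absurd ((hmem₀ u).1 (huv ▸ (hmem₀ v).2 (by
        rw [Sym2.mem_iff, ← hs]; exact hv))) (by rw [Sym2.mem_iff, ← hs]; exact not_not.2 hu)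
    · exact absurd ((hmem₀ v).1 (huv ▸ (hmem₀ u).2 (by
        rw [Sym2.mem_iff, ← hs]; exact hu))) (by rw [Sym2.mem_iff, ← hs]; exact not_not.2 hv)
    · rcases (hs u).1 hu with rfl | rfl <;> rcases (hs v).1 hv with rfl | rfl
      · rfl
      · exact absurd (hfa.symm.trans (huv.trans hfb)) hyy'
      · exact absurd (hfa.symm.trans (huv.symm.trans hfb)) hyy'
      · rfl
  have half : ∀ u v, u ∉ s → F.Adj u v → s(u, v) ≠ s(a, b) →
      (H.goodGraph M).Adj (f u) (f v) := by
    intro u v hu huv hne'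
    have hv : v ∈ s := by
      by_contra hv
      have huv' := F.ne_of_adj huv
      rcases (hs u).1 hu with rfl | rfl <;> rcases (hs v).1 hv with rfl | rfl
      · exact huv' rfl
      · exact hne' rfl
      · exact hne' Sym2.eq_swap
      · exact huv' rfl
    have hci := hcol u v huv hne'
    rcases (hs u).1 hu with rfl | rfl
    · rw [hfa]
      exact (hC3 v (fun h => hci (ha.trans h.symm)) _ (hfC v hv)).1
    · rw [hfb]
      exact (hC3 v (fun h => hci (hb.trans h.symm)) _ (hfC v hv)).2
  refine not_free_expansion_of_goodGraph hr F H hM f hfinj ⟨s(a, b), hab⟩ E₀ hE₀ hmem₀ ?_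
  intro u v huv hne'
  by_cases hu : u ∈ s
  · by_cases hv : v ∈ s
    · exact hadj u hu v hv (hcol u v huv hne')
    · exact (half v u hv huv.symm (by rwa [Sym2.eq_swap])).symm
  · exact half u v hu huv hne'

end RGraph

/-! ### The Lagrange polynomial of the complete `r`-graph -/

namespace RGraph

section Lagrangian

variable {r ℓ : ℕ} {VQ : Type v}

theorem isHom_complete_iff {Q : RGraph r VQ} {φ : VQ → Fin ℓ} :
    Q.IsHom (complete r ℓ) φ ↔ ∀ e ∈ Q.edges, Set.InjOn φ e := by
  refine forall₂_congr fun e he => ?_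
  change (e.image φ).card = r ↔ _
  rw [← Q.uniform e he, Finset.card_image_iff]

/-- The hypothesis `h0` excludes the default value `sInf ∅ = 0`, so the minimum is attained; the
colouring is then included into the larger palette. -/
theorem isPartite_of_chromaticNumber_le {Q : RGraph r VQ} (h0 : Q.chromaticNumber ≠ 0)
    (h : Q.chromaticNumber ≤ ℓ) : Q.IsPartite ℓ := by
  have hne : {m : ℕ | Q.IsPartite m}.Nonempty := by
    by_contra hne
    rw [Set.not_nonempty_iff_eq_empty] at hne
    exact h0 (by rw [chromaticNumber, hne, Nat.sInf_empty])
  obtain ⟨φ, hφ⟩ := Nat.sInf_mem hne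
  refine ⟨fun q => Fin.castLE h (φ q), ?_⟩
  rw [isHom_complete_iff] at hφ ⊢
  exact fun e he a ha b hb hab => hφ e he ha hb (Fin.castLE_injective h hab)

theorem exists_edge_of_two_le_chromaticNumber {Q : RGraph r VQ} (h : 2 ≤ Q.chromaticNumber) :
    ∃ e, e ∈ Q.edges := by
  by_contra! hne
  have : Q.IsPartite 1 := ⟨fun _ => 0, fun e he => absurd he (hne e)⟩
  have h1 : Q.chromaticNumber ≤ 1 := Nat.sInf_le this
  omega

variable [Fintype VQ] (Q : RGraph r VQ)

theorem continuous_lagrangePoly : Continuous (Q.lagrangePoly (complete r ℓ)) := by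
  unfold lagrangePoly
  fun_prop

theorem lagrangePoly_le_lagrangian {x : Fin ℓ → ℝ} (hx : x ∈ stdSimplex ℝ (Fin ℓ)) :
    Q.lagrangePoly (complete r ℓ) x ≤ Q.lagrangian (complete r ℓ) :=
  le_csSup (((isCompact_stdSimplex ℝ (Fin ℓ)).image Q.continuous_lagrangePoly).bddAbove)
    ⟨x, hx, rfl⟩

theorem lagrangePoly_smul (t : ℝ) (x : Fin ℓ → ℝ) :
    Q.lagrangePoly (complete r ℓ) (fun i => t * x i) =
      t ^ Fintype.card VQ * Q.lagrangePoly (complete r ℓ) x := by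
  simp [lagrangePoly, Finset.prod_mul_distrib, Finset.mul_sum, Finset.card_univ]

theorem lagrangePoly_le_pow {x : Fin ℓ → ℝ} (hx : ∀ i, 0 ≤ x i) :
    Q.lagrangePoly (complete r ℓ) x ≤ (∑ i, x i) ^ Fintype.card VQ := by
  classical
  have h : (∑ i, x i) ^ Fintype.card VQ = ∑ φ : VQ → Fin ℓ, ∏ q, x (φ q) := by
    have := Finset.prod_univ_sum (fun _ : VQ => (Finset.univ : Finset (Fin ℓ))) (fun _ i => x i)
    simpa [Finset.card_univ] using this
  rw [h]
  exact Finset.sum_le_sum_of_subset_of_nonneg (Finset.filter_subset _ _)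
    (fun _ _ _ => Finset.prod_nonneg fun _ _ => hx _)

theorem lagrangian_le_one : Q.lagrangian (complete r ℓ) ≤ 1 := by
  refine Real.sSup_le ?_ zero_le_one
  rintro _ ⟨x, hx, rfl⟩
  refine (Q.lagrangePoly_le_pow hx.1).trans ?_
  rw [hx.2, one_pow]

theorem lagrangePoly_le_lagrangian_mul (x : Fin ℓ → ℝ) (hx : ∀ i, 0 ≤ x i) {n : ℝ} (hn : 0 < n)
    (hsum : ∑ i, x i = n) :
    Q.lagrangePoly (complete r ℓ) x ≤ Q.lagrangian (complete r ℓ) * n ^ Fintype.card VQ := by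
  have h : x = fun i => n * (n⁻¹ * x i) := by
    funext i
    field_simp
  have hs : (fun i => n⁻¹ * x i) ∈ stdSimplex ℝ (Fin ℓ) := by
    refine ⟨fun i => mul_nonneg (inv_nonneg.2 hn.le) (hx i), ?_⟩
    rw [← Finset.mul_sum, hsum, inv_mul_cancel₀ hn.ne']
  rw [h, lagrangePoly_smul, mul_comm]
  exact mul_le_mul_of_nonneg_right (Q.lagrangePoly_le_lagrangian hs) (by positivity)

theorem lagrangian_pos (hℓ : 0 < ℓ) (hQ : Q.IsPartite ℓ) :
    0 < Q.lagrangian (complete r ℓ) := by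
  classical
  obtain ⟨φ, hφ⟩ := hQ
  have hs : (fun _ => (ℓ : ℝ)⁻¹) ∈ stdSimplex ℝ (Fin ℓ) := by
    refine ⟨fun _ => by positivity, ?_⟩
    simp [hℓ.ne']
  refine lt_of_lt_of_le ?_ (Q.lagrangePoly_le_lagrangian hs)
  refine Finset.sum_pos (fun _ _ => Finset.prod_pos fun _ _ => by positivity) ⟨φ, ?_⟩
  simpa using hφ

/-- A maximizer of the Lagrange polynomial of a complete `r`-graph has no zero coordinate. -/
theorem exists_lagrangePoly_lt (hr : 2 ≤ r) {e : Finset VQ} (he : e ∈ Q.edges)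
    {x : Fin ℓ → ℝ} (hx : x ∈ stdSimplex ℝ (Fin ℓ)) (hpos : 0 < Q.lagrangePoly (complete r ℓ) x)
    {i : Fin ℓ} (hi : x i = 0) :
    ∃ x' ∈ stdSimplex ℝ (Fin ℓ),
      Q.lagrangePoly (complete r ℓ) x < Q.lagrangePoly (complete r ℓ) x' := by
  classical
  obtain ⟨φ, hφ, hφpos⟩ := Finset.exists_lt_of_sum_lt
    (s := Finset.univ.filter fun φ : VQ → Fin ℓ => Q.IsHom (complete r ℓ) φ) (f := fun _ => (0 : ℝ))
    (g := fun φ => ∏ q, x (φ q)) (by simpa [lagrangePoly] using hpos)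
  have hφ : ∀ e ∈ Q.edges, Set.InjOn φ e := isHom_complete_iff.1 (by simpa using hφ)
  have hxφ : ∀ q, 0 < x (φ q) := fun q => lt_of_le_of_ne (hx.1 _) fun h =>
    hφpos.ne (Finset.prod_eq_zero (Finset.mem_univ q) h.symm).symm
  obtain ⟨u, hu, w, hw, huw⟩ := Finset.one_lt_card.1
    (show 1 < e.card by rw [Q.uniform e he]; omega)
  have hφuw : φ u ≠ φ w := fun h => huw (hφ e he hu hw h)
  have hne : ∀ q, φ q ≠ i := fun q h => (hxφ q).ne' (h ▸ hi)
  set b := φ w with hb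
  have hbi : b ≠ i := hne w
  -- Half the weight of `b` moves to the unused colour `i`. The map `μ` merges `i` back into `b`,
  -- and the `x'`-weight of each fibre of `μ` is the old weight.
  let x' : Fin ℓ → ℝ := fun j => if j = i then x b / 2 else if j = b then x b / 2 else x j
  let μ : Fin ℓ → Fin ℓ := fun j => if j = i then b else j
  have hx'0 : ∀ j, 0 ≤ x' j := by
    intro j
    simp only [x']
    have := hx.1 b
    have := hx.1 j
    split_ifs <;> linarith
  have hfib : ∀ k, ∑ j ∈ Finset.univ.filter (fun j => μ j = k), x' j = x k := by
    intro k
    by_cases hkb : k = b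
    · have : Finset.univ.filter (fun j => μ j = k) = {i, b} := by
        ext j
        simp only [μ, hkb, Finset.mem_filter, Finset.mem_univ, true_and, Finset.mem_insert,
          Finset.mem_singleton]
        split_ifs with h <;> simp [h]
      rw [this, Finset.sum_pair hbi.symm]
      simp [x', hkb]
    · by_cases hki : k = i
      · have : Finset.univ.filter (fun j => μ j = k) = ∅ := by
          ext j
          simp only [μ, hki, Finset.mem_filter, Finset.mem_univ, true_and, Finset.notMem_empty,
            iff_false]
          split_ifs with h <;> simp [h, hbi]
        rw [this, hki, hi, Finset.sum_empty]
      · have : Finset.univ.filter (fun j => μ j = k) = {k} := by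
          ext j
          simp only [μ, Finset.mem_filter, Finset.mem_univ, true_and, Finset.mem_singleton]
          split_ifs with h
          · simp [h, Ne.symm hkb, Ne.symm hki]
          · rfl
        rw [this, Finset.sum_singleton]
        simp [x', hkb, hki]
  have hx' : x' ∈ stdSimplex ℝ (Fin ℓ) := by
    refine ⟨hx'0, ?_⟩
    rw [← hx.2, ← Finset.sum_fiberwise Finset.univ μ x']
    exact Finset.sum_congr rfl fun k _ => hfib k
  refine ⟨x', hx', ?_⟩
  -- Expanding every factor over its `μ`-fibre writes the old polynomial as the `x'`-weight of those
  -- `φ` for which even `μ ∘ φ` is a homomorphism. Every such `φ` is itself one, so only a strict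
  -- gain remains to be found.
  have hprod : ∀ ψ : VQ → Fin ℓ, ∏ q, x (ψ q) =
      ∑ φ ∈ Finset.univ.filter (fun φ : VQ → Fin ℓ => μ ∘ φ = ψ), ∏ q, x' (φ q) := by
    intro ψ
    simp only [← hfib]
    rw [Finset.prod_univ_sum]
    refine Finset.sum_congr ?_ fun _ _ => rfl
    ext φ
    simp [Fintype.mem_piFinset, funext_iff]
  have hsum : Q.lagrangePoly (complete r ℓ) x =
      ∑ φ ∈ Finset.univ.filter (fun φ : VQ → Fin ℓ => Q.IsHom (complete r ℓ) (μ ∘ φ)),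
        ∏ q, x' (φ q) := by
    symm
    rw [← Finset.sum_fiberwise_of_maps_to
      (t := Finset.univ.filter fun ψ : VQ → Fin ℓ => Q.IsHom (complete r ℓ) ψ)
      (g := fun φ => μ ∘ φ) (fun φ hφ => by simpa using hφ), lagrangePoly]
    refine Finset.sum_congr rfl fun ψ hψ => ?_
    rw [hprod ψ, Finset.filter_filter]
    refine Finset.sum_congr (Finset.filter_congr fun φ _ => ?_) fun _ _ => rfl
    exact ⟨fun h => h.2, fun h => ⟨h ▸ (Finset.mem_filter.1 hψ).2, h⟩⟩
  rw [hsum, lagrangePoly]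
  have hφ' : ∀ q, (Equiv.swap (φ u) i) (φ q) ≠ φ u := by
    intro q h
    rw [Equiv.swap_apply_eq_iff, Equiv.swap_apply_left] at h
    exact hne q h
  -- The gain comes from giving `u` the new colour `i` while `w` keeps `b`: this is a homomorphism
  -- of positive weight, but `μ` identifies the colours of `u` and `w`, which share the edge `e`.
  refine Finset.sum_lt_sum_of_subset (i := fun q => Equiv.swap (φ u) i (φ q)) ?_ ?_ ?_ ?_
    fun _ _ _ => Finset.prod_nonneg fun _ _ => hx'0 _
  · intro ψ hψ
    simp only [Finset.mem_filter, Finset.mem_univ, true_and, isHom_complete_iff] at hψ ⊢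
    exact fun e he => (hψ e he).of_comp
  · simp only [Finset.mem_filter, Finset.mem_univ, true_and, isHom_complete_iff]
    exact fun e he a ha c hc hac => hφ e he ha hc ((Equiv.swap (φ u) i).injective hac)
  · simp only [Finset.mem_filter, Finset.mem_univ, true_and, isHom_complete_iff]
    intro h
    refine huw (h e he hu hw ?_)
    simp only [Function.comp, μ]
    rw [← hb, Equiv.swap_apply_left, Equiv.swap_apply_of_ne_of_ne hφuw.symm hbi]
    simp
  · refine Finset.prod_pos fun q _ => ?_
    have hxb : 0 < x b := hxφ w
    simp only [x']
    split_ifs with h1 h2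
    · linarith
    · linarith
    · have : φ q ≠ φ u := by
        intro h
        rw [h, Equiv.swap_apply_left] at h1
        exact h1 rfl
      rw [Equiv.swap_apply_of_ne_of_ne this (hne q)]
      exact hxφ q

/-- Near-maximizers of the Lagrange polynomial of a complete `r`-graph have all coordinates
bounded away from zero. -/
theorem exists_coord_ge_of_near_lagrangian (hr : 2 ≤ r) (hℓ : 0 < ℓ) {e : Finset VQ}
    (he : e ∈ Q.edges) (hQ : Q.IsPartite ℓ) :
    ∃ c : ℝ, 0 < c ∧ ∀ x ∈ stdSimplex ℝ (Fin ℓ),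
      Q.lagrangian (complete r ℓ) - c ≤ Q.lagrangePoly (complete r ℓ) x → ∀ i, c ≤ x i := by
  have hpos := Q.lagrangian_pos hℓ hQ
  -- The deficit from the maximum plus `x i` is continuous and nonnegative on the compact simplex.
  -- It never vanishes, as that would be a maximizer with a zero coordinate, so it is at least some
  -- `2 * c`; a deficit of at most `c` leaves `x i ≥ c`.
  have hstep : ∀ i : Fin ℓ, ∃ c : ℝ, 0 < c ∧ ∀ x ∈ stdSimplex ℝ (Fin ℓ),
      2 * c ≤ Q.lagrangian (complete r ℓ) - Q.lagrangePoly (complete r ℓ) x + x i := by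
    intro i
    have hne : (stdSimplex ℝ (Fin ℓ)).Nonempty := ⟨_, single_mem_stdSimplex ℝ i⟩
    have hcont : Continuous fun x : Fin ℓ → ℝ =>
        Q.lagrangian (complete r ℓ) - Q.lagrangePoly (complete r ℓ) x + x i :=
      (continuous_const.sub Q.continuous_lagrangePoly).add (continuous_apply i)
    obtain ⟨x, hx, hmin⟩ := (isCompact_stdSimplex ℝ (Fin ℓ)).exists_isMinOn hne hcont.continuousOn
    have hle := Q.lagrangePoly_le_lagrangian hx
    refine ⟨(Q.lagrangian (complete r ℓ) - Q.lagrangePoly (complete r ℓ) x + x i) / 2, ?_, ?_⟩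
    · have hxi := hx.1 i
      rcases hxi.eq_or_lt with h0 | h0
      · rcases hle.eq_or_lt with h1 | h1
        · obtain ⟨x', hx', hlt⟩ := Q.exists_lagrangePoly_lt hr he hx (h1 ▸ hpos) h0.symm
          exact absurd (Q.lagrangePoly_le_lagrangian hx') (not_le.2 (h1 ▸ hlt))
        · linarith
      · linarith
    · intro z hz
      have := hmin hz
      simp only [Set.mem_ofPred_eq] at this
      linarith
  choose c hc0 hc using hstep
  have hne : (Finset.univ : Finset (Fin ℓ)).Nonempty := ⟨⟨0, hℓ⟩, Finset.mem_univ _⟩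
  refine ⟨Finset.univ.inf' hne c, (Finset.lt_inf'_iff hne).2 fun i _ => hc0 i,
    fun x hx hle i => ?_⟩
  have h1 := hc i x hx
  have h2 : Finset.univ.inf' hne c ≤ c i := Finset.inf'_le _ (Finset.mem_univ i)
  linarith

open Classical in
/-- The partial derivative of the Lagrange polynomial of `K_ℓ^r` in the `i`-th variable. -/
noncomputable def lagrangeDeriv (i : Fin ℓ) (x : Fin ℓ → ℝ) : ℝ :=
  ∑ p : VQ, ∑ ψ : VQ → Fin ℓ with Q.IsHom (complete r ℓ) ψ ∧ ψ p = i,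
    ∏ u ∈ Finset.univ.erase p, x (ψ u)

theorem lagrangeDeriv_nonneg (i : Fin ℓ) {x : Fin ℓ → ℝ} (hx : ∀ i, 0 ≤ x i) :
    0 ≤ Q.lagrangeDeriv i x :=
  Finset.sum_nonneg fun _ _ => Finset.sum_nonneg fun _ _ => Finset.prod_nonneg fun _ _ => hx _

/-- Euler's identity for the Lagrange polynomial. -/
theorem sum_mul_lagrangeDeriv (x : Fin ℓ → ℝ) :
    ∑ i, x i * Q.lagrangeDeriv i x =
      Fintype.card VQ * Q.lagrangePoly (complete r ℓ) x := by
  classical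
  have h : ∀ p : VQ, ∑ i, x i * ∑ ψ : VQ → Fin ℓ with Q.IsHom (complete r ℓ) ψ ∧ ψ p = i,
      ∏ u ∈ Finset.univ.erase p, x (ψ u) = Q.lagrangePoly (complete r ℓ) x := by
    intro p
    rw [lagrangePoly, ← Finset.sum_fiberwise _ (fun ψ : VQ → Fin ℓ => ψ p)]
    refine Finset.sum_congr rfl fun i _ => ?_
    rw [Finset.filter_filter, Finset.mul_sum]
    refine Finset.sum_congr rfl fun ψ hψ => ?_
    rw [← (Finset.mem_filter.1 hψ).2.2]
    exact Finset.mul_prod_erase Finset.univ (fun u => x (ψ u)) (Finset.mem_univ p)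
  simp only [lagrangeDeriv, Finset.mul_sum (s := (Finset.univ : Finset VQ))]
  rw [Finset.sum_comm, Finset.sum_congr rfl fun p _ => h p]
  simp [Finset.card_univ]

end Lagrangian

end RGraph

/-! ### Counting homomorphisms through a vertex -/

open Classical in
theorem Fintype.card_piFinset_ite_mem {VQ : Type v} [Fintype VQ] {V : Type u} [Fintype V]
    (T : Finset VQ) (s : VQ → Finset V) :
    (Fintype.piFinset fun u => if u ∈ T then s u else Finset.univ).card =
      (∏ u ∈ T, (s u).card) * Fintype.card V ^ (Fintype.card VQ - T.card) := by
  rw [Fintype.card_piFinset, ← Finset.prod_mul_prod_compl T]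
  congr 1
  · exact Finset.prod_congr rfl fun u hu => by rw [if_pos hu]
  · rw [← Finset.card_compl, ← Finset.card_univ (α := V)]
    exact Finset.prod_eq_pow_card fun u hu => by rw [if_neg (Finset.mem_compl.1 hu)]

namespace RGraph

section Counting

variable {r ℓ : ℕ} {VQ : Type v} [Fintype VQ] {V : Type u} [Fintype V]

open Classical in
/-- The sizes of the colour classes. -/
noncomputable def classSize (c : V → Fin ℓ) (j : Fin ℓ) : ℝ :=
  ((Finset.univ.filter fun z => c z = j).card : ℝ)

theorem classSize_nonneg (c : V → Fin ℓ) (j : Fin ℓ) : 0 ≤ classSize c j := Nat.cast_nonneg _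

theorem sum_classSize_mul (c : V → Fin ℓ) (g : Fin ℓ → ℝ) :
    ∑ j, classSize c j * g j = ∑ z, g (c z) := by
  classical
  rw [← Finset.sum_fiberwise Finset.univ c]
  refine Finset.sum_congr rfl fun j _ => ?_
  rw [Finset.sum_congr rfl (g := fun _ => g j) (fun z hz => by rw [(Finset.mem_filter.1 hz).2]),
    Finset.sum_const, nsmul_eq_mul]
  simp only [classSize]

theorem sum_classSize (c : V → Fin ℓ) : ∑ j, classSize c j = Fintype.card V := by
  simpa [Finset.card_univ] using sum_classSize_mul c fun _ => 1

open Classical in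
/-- The vertices of colour `j` that are not good neighbours of `y`. -/
noncomputable def missing (H : RGraph r V) (M : ℕ) (c : V → Fin ℓ) (y : V) (j : Fin ℓ) :
    Finset V :=
  Finset.univ.filter fun u => c u = j ∧ ¬ (H.goodGraph M).Adj y u

open Classical in
-- Maps are sorted by their colour pattern `ψ`. The right-hand side is the summand of `p` in
-- `lagrangeDeriv` at the class sizes.
theorem card_pi_eq_and_isHom_le (Q : RGraph r VQ) (c : V → Fin ℓ) (y : V) (p : VQ) :
    ((Finset.univ.filter fun φ : VQ → V =>
      φ p = y ∧ Q.IsHom (complete r ℓ) (fun q => c (φ q))).card : ℝ) ≤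
      ∑ ψ : VQ → Fin ℓ with Q.IsHom (complete r ℓ) ψ ∧ ψ p = c y,
        ∏ u ∈ Finset.univ.erase p, classSize c (ψ u) := by
  have hsub : (Finset.univ.filter fun φ : VQ → V =>
      φ p = y ∧ Q.IsHom (complete r ℓ) (fun q => c (φ q))) ⊆
      (Finset.univ.filter fun ψ : VQ → Fin ℓ => Q.IsHom (complete r ℓ) ψ ∧ ψ p = c y).biUnion
        fun ψ => Fintype.piFinset fun u =>
          if u = p then {y} else Finset.univ.filter fun z => c z = ψ u := by
    intro φ hφ
    simp only [Finset.mem_filter, Finset.mem_univ, true_and] at hφ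
    refine Finset.mem_biUnion.2 ⟨fun q => c (φ q), by simp [hφ.1, hφ.2], ?_⟩
    rw [Fintype.mem_piFinset]
    intro u
    split_ifs with h
    · simp [h, hφ.1]
    · simp
  refine (Nat.cast_le.2 ((Finset.card_le_card hsub).trans Finset.card_biUnion_le)).trans ?_
  push_cast
  refine Finset.sum_le_sum fun ψ _ => le_of_eq ?_
  rw [Fintype.card_piFinset, ← Finset.mul_prod_erase Finset.univ _ (Finset.mem_univ p)]
  rw [if_pos rfl, Finset.card_singleton, one_mul, Nat.cast_prod]
  refine Finset.prod_congr rfl fun u hu => ?_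
  rw [if_neg (Finset.ne_of_mem_erase hu), classSize]

open Classical in
/-- Functions through `y` sending a further vertex to a non-neighbour of `y`, subject to a
homomorphism of colours, are numerous if `y` has many non-neighbours. -/
theorem card_good_add_missing_le (Q : RGraph r VQ) (H : RGraph r V) (M : ℕ) (c : V → Fin ℓ)
    {y : V} {p w : VQ} {ψ : VQ → Fin ℓ} (hψ : Q.IsHom (complete r ℓ) ψ) (hpw : p ≠ w)
    (hψp : ψ p = c y) {a : ℝ} (ha : 0 ≤ a) (hclass : ∀ j, a ≤ classSize c j) :
    ((Finset.univ.filter fun φ : VQ → V => φ p = y ∧ Q.IsHom (complete r ℓ) (fun q => c (φ q)) ∧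
        (H.goodGraph M).Adj y (φ w)).card : ℝ) +
      (missing H M c y (ψ w)).card * a ^ (Fintype.card VQ - 2) ≤
    ((Finset.univ.filter fun φ : VQ → V =>
      φ p = y ∧ Q.IsHom (complete r ℓ) (fun q => c (φ q))).card : ℝ) := by
  set B : Finset (VQ → V) := Fintype.piFinset fun u => if u = p then {y} else
    if u = w then missing H M c y (ψ w) else Finset.univ.filter fun z => c z = ψ u with hB
  have hBmem : ∀ φ ∈ B, φ p = y ∧ φ w ∈ missing H M c y (ψ w) ∧ ∀ u, c (φ u) = ψ u := by
    intro φ hφ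
    rw [hB, Fintype.mem_piFinset] at hφ
    have h1 : φ p = y := by simpa using hφ p
    have h2 : φ w ∈ missing H M c y (ψ w) := by simpa [hpw.symm] using hφ w
    refine ⟨h1, h2, fun u => ?_⟩
    by_cases hup : u = p
    · rw [hup, h1, hψp]
    · by_cases huw : u = w
      · rw [huw]
        exact (Finset.mem_filter.1 h2).2.1
      · simpa [hup, huw] using hφ u
  have hcardB : ((missing H M c y (ψ w)).card : ℝ) * a ^ (Fintype.card VQ - 2) ≤ B.card := by
    rw [hB, Fintype.card_piFinset, ← Finset.mul_prod_erase Finset.univ _ (Finset.mem_univ p),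
      ← Finset.mul_prod_erase (Finset.univ.erase p) _
        (Finset.mem_erase.2 ⟨hpw.symm, Finset.mem_univ w⟩)]
    rw [if_pos rfl, Finset.card_singleton, one_mul, if_neg hpw.symm, if_pos rfl, Nat.cast_mul]
    refine mul_le_mul_of_nonneg_left ?_ (Nat.cast_nonneg _)
    have hc : ((Finset.univ.erase p).erase w).card = Fintype.card VQ - 2 := by
      rw [Finset.card_erase_of_mem (Finset.mem_erase.2 ⟨hpw.symm, Finset.mem_univ w⟩),
        Finset.card_erase_of_mem (Finset.mem_univ p), Finset.card_univ, Nat.sub_sub]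
    rw [← hc, Nat.cast_prod, ← Finset.prod_const]
    refine Finset.prod_le_prod (fun _ _ => ha) fun u hu => ?_
    simp only [Finset.mem_erase] at hu
    rw [if_neg hu.2.1, if_neg hu.1]
    exact hclass (ψ u)
  refine (add_le_add_right hcardB _).trans ?_
  rw [← Nat.cast_add, Nat.cast_le, ← Finset.card_union_of_disjoint]
  · refine Finset.card_le_card (Finset.union_subset ?_ ?_)
    · intro φ hφ
      simp only [Finset.mem_filter, Finset.mem_univ, true_and] at hφ ⊢
      exact ⟨hφ.1, hφ.2.1⟩
    · intro φ hφ
      obtain ⟨h1, -, h2⟩ := hBmem φ hφ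
      simp only [Finset.mem_filter, Finset.mem_univ, true_and]
      exact ⟨h1, (funext h2 : (fun q => c (φ q)) = ψ) ▸ hψ⟩
  · rw [Finset.disjoint_left]
    intro φ hφ hφB
    exact (Finset.mem_filter.1 (hBmem φ hφB).2.1).2.2 (Finset.mem_filter.1 hφ).2.2.2

open Classical in
-- With `φ p` fixed, `φ w` is free and then `φ u` has at most `M` values, so one power of the number
-- of vertices is saved.
theorem card_pi_mem_dependent_le {p w u : VQ} (hwp : w ≠ p) (hup : u ≠ p) (huw : u ≠ w) (y : V)
    {M : ℕ} (S : V → Finset V) (hS : ∀ z, (S z).card ≤ M) :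
    (Finset.univ.filter fun φ : VQ → V => φ p = y ∧ φ u ∈ S (φ w)).card ≤
      M * Fintype.card V ^ (Fintype.card VQ - 2) := by
  have hsub : (Finset.univ.filter fun φ : VQ → V => φ p = y ∧ φ u ∈ S (φ w)) ⊆
      Finset.univ.biUnion fun z => Fintype.piFinset fun t => if t ∈ ({p, w, u} : Finset VQ) then
        (if t = p then {y} else if t = w then {z} else S z) else Finset.univ := by
    intro φ hφ
    simp only [Finset.mem_filter, Finset.mem_univ, true_and] at hφ
    refine Finset.mem_biUnion.2 ⟨φ w, Finset.mem_univ _, Fintype.mem_piFinset.2 fun t => ?_⟩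
    split_ifs with h1 h2 h3
    · simp [h2, hφ.1]
    · simp [h3]
    · simp only [Finset.mem_insert, Finset.mem_singleton, h2, h3, false_or] at h1
      rw [h1]
      exact hφ.2
    · simp
  have hT : ({p, w, u} : Finset VQ).card = 3 :=
    Finset.card_eq_three.2 ⟨p, w, u, hwp.symm, hup.symm, huw.symm, rfl⟩
  have h3 : 3 ≤ Fintype.card VQ := hT ▸ Finset.card_le_univ _
  refine (Finset.card_le_card hsub).trans ((Finset.card_biUnion_le_card_mul _ _
    (M * Fintype.card V ^ (Fintype.card VQ - 3)) fun z _ => ?_).trans (le_of_eq ?_))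
  · rw [Fintype.card_piFinset_ite_mem, hT]
    refine Nat.mul_le_mul_right _ ?_
    rw [Finset.prod_insert (by simp [hwp.symm, hup.symm]), Finset.prod_pair huw.symm]
    simpa [hwp, hup, huw] using hS z
  · rw [Finset.card_univ, show Fintype.card VQ - 2 = Fintype.card VQ - 3 + 1 by omega, pow_succ]
    ring

open Classical in
theorem card_pi_mem_le {p w : VQ} (hwp : w ≠ p) (y : V) (S : Finset V) :
    (Finset.univ.filter fun φ : VQ → V => φ p = y ∧ φ w ∈ S).card ≤
      S.card * Fintype.card V ^ (Fintype.card VQ - 2) := by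
  have hsub : (Finset.univ.filter fun φ : VQ → V => φ p = y ∧ φ w ∈ S) ⊆
      Fintype.piFinset fun t => if t ∈ ({p, w} : Finset VQ) then
        (if t = p then {y} else S) else Finset.univ := by
    intro φ hφ
    simp only [Finset.mem_filter, Finset.mem_univ, true_and] at hφ
    refine Fintype.mem_piFinset.2 fun t => ?_
    split_ifs with h1 h2
    · simp [h2, hφ.1]
    · simp only [Finset.mem_insert, Finset.mem_singleton, h2, false_or] at h1
      rw [h1]
      exact hφ.2
    · simp
  refine (Finset.card_le_card hsub).trans (le_of_eq ?_)
  rw [Fintype.card_piFinset_ite_mem, Finset.prod_pair hwp.symm, Finset.card_pair hwp.symm]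
  simp [hwp]

open Classical in
/-- The injective homomorphisms through `y` that send a vertex sharing an edge with the preimage of
`y` to a vertex that is not a good neighbour of `y` form a set of lower order. -/
theorem exists_card_bad_le (Q : RGraph r VQ) (H : RGraph r V) (M : ℕ) (y : V) (p : VQ) :
    ∃ B : Finset (VQ → V),
      B.card ≤ Fintype.card VQ * (Fintype.card VQ *
        (M * Fintype.card V ^ (Fintype.card VQ - 2))) ∧
      ∀ f ∈ Q.Inj H, f p = y → ⇑f ∉ B → ∀ e ∈ Q.edges, p ∈ e → ∀ w ∈ e, w ≠ p →
        (H.goodGraph M).Adj y (f w) := by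
  -- A non-good pair `y`, `z` is blocked by a set `S z` of at most `M` vertices. If `p` and `w`
  -- share an edge of `Q` and `f w` is not good for `y`, a third vertex of that edge must land in `S
  -- (f w)`.
  have hS : ∀ z, ∃ S : Finset V, S.card ≤ M ∧ (y ≠ z → ¬ (H.goodGraph M).Adj y z →
      y ∉ S ∧ z ∉ S ∧ ∀ E ∈ H.edges, y ∈ E → z ∈ E → ¬ Disjoint E S) := by
    intro z
    by_cases h : y ≠ z ∧ ¬ (H.goodGraph M).Adj y z
    · have h2 := h.2
      simp only [goodGraph, not_and, not_forall] at h2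
      obtain ⟨S, hS, hy, hz, hE⟩ := h2 h.1
      exact ⟨S, hS, fun _ _ => ⟨hy, hz, fun E hE' h1 h2 h3 => hE ⟨E, hE', h1, h2, h3⟩⟩⟩
    · exact ⟨∅, by simp, fun h1 h2 => absurd ⟨h1, h2⟩ h⟩
  choose S hSM hS using hS
  refine ⟨Finset.univ.biUnion fun w => Finset.univ.biUnion fun u =>
    if w ≠ p ∧ u ≠ p ∧ u ≠ w then
      Finset.univ.filter fun φ : VQ → V => φ p = y ∧ φ u ∈ S (φ w) else ∅, ?_, ?_⟩
  · rw [← Finset.card_univ (α := VQ)]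
    refine Finset.card_biUnion_le_card_mul _ _ _ fun w _ =>
      Finset.card_biUnion_le_card_mul _ _ _ fun u _ => ?_
    split_ifs with h
    · exact card_pi_mem_dependent_le h.1 h.2.1 h.2.2 y S hSM
    · simp
  · intro f hf hfp hfB e he hpe w hwe hwp
    by_contra hna
    have hyw : y ≠ f w := fun h => hwp (f.injective (hfp.trans h).symm)
    obtain ⟨hyS, hwS, hd⟩ := hS (f w) hyw hna
    have := hd _ (hf e he) (hfp ▸ Finset.mem_map_of_mem f hpe) (Finset.mem_map_of_mem f hwe)
    rw [Finset.not_disjoint_iff] at this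
    obtain ⟨z, hz, hzS⟩ := this
    obtain ⟨u, hu, rfl⟩ := Finset.mem_map.1 hz
    have hup : u ≠ p := by rintro rfl; exact hyS (hfp ▸ hzS)
    have huw : u ≠ w := by rintro rfl; exact hwS hzS
    refine hfB (Finset.mem_biUnion.2 ⟨w, Finset.mem_univ _, Finset.mem_biUnion.2
      ⟨u, Finset.mem_univ _, ?_⟩⟩)
    rw [if_pos ⟨hwp, hup, huw⟩]
    simpa [hfp] using hzS

open Classical in
-- Homomorphisms through `y` are split by the preimage `p` of `y`. Apart from the exceptional set `X
-- p` and the maps using a non-good pair at `y`, they are counted by the derivative. The derivative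
-- also counts maps sending some `w₀` that shares an edge with `p₀` to a missing vertex, and these
-- give the extra term on the left. The set `X` is left open because `y ≠ x` and `y = x` need
-- different exceptions.
theorem qDegree_add_missing_le_of_exceptional (hr : 2 ≤ r) (Q : RGraph r VQ) (H : RGraph r V)
    (M : ℕ) {e : Finset VQ} (he : e ∈ Q.edges) (hQ : Q.IsPartite ℓ) (c : V → Fin ℓ) (y : V)
    {a : ℝ} (ha : 0 ≤ a) (hclass : ∀ j, a ≤ classSize c j) (X : VQ → Finset (VQ → V)) (J : ℝ)
    (hX : ∀ p, ((X p).card : ℝ) ≤ J)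
    (hhom : ∀ f ∈ Q.Inj H, ∀ p, f p = y → ⇑f ∉ X p →
      (∀ e ∈ Q.edges, p ∈ e → ∀ w ∈ e, w ≠ p → (H.goodGraph M).Adj y (f w)) →
      Q.IsHom (complete r ℓ) fun q => c (f q))
    {j : Fin ℓ} (hj : j ≠ c y) :
    (Q.qDegree H y : ℝ) + (missing H M c y j).card * a ^ (Fintype.card VQ - 2) ≤
      Q.lagrangeDeriv (c y) (classSize c) + Fintype.card VQ * (J + Fintype.card VQ *
        (Fintype.card VQ * (M * (Fintype.card V : ℝ) ^ (Fintype.card VQ - 2)))) := by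
  choose B hBcard hB using exists_card_bad_le Q H M y
  let G : VQ → Finset (VQ → V) := fun p => Finset.univ.filter fun φ : VQ → V =>
    φ p = y ∧ Q.IsHom (complete r ℓ) (fun q => c (φ q)) ∧
      ∀ e ∈ Q.edges, p ∈ e → ∀ w ∈ e, w ≠ p → (H.goodGraph M).Adj y (φ w)
  have hdeg : Q.qDegree H y ≤ ∑ p, ((G p).card + ((X p).card + (B p).card)) := by
    have h1 : Q.qDegree H y ≤ (Finset.univ.biUnion fun p => G p ∪ (X p ∪ B p)).card := by
      rw [qDegree, ← Set.ncard_image_of_injective _ (DFunLike.coe_injective (F := VQ ↪ V)),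
        ← Set.ncard_coe_finset]
      refine Set.ncard_le_ncard ?_ (Finset.finite_toSet _)
      rintro _ ⟨f, ⟨hf, p, hp⟩, rfl⟩
      refine Finset.mem_coe.2 (Finset.mem_biUnion.2 ⟨p, Finset.mem_univ _, ?_⟩)
      by_cases hfX : ⇑f ∈ X p
      · simp [hfX]
      by_cases hfB : ⇑f ∈ B p
      · simp [hfB]
      have hg := hB p f hf hp hfB
      refine Finset.mem_union_left _ (Finset.mem_filter.2 ⟨Finset.mem_univ _, hp, ?_, hg⟩)
      exact hhom f hf p hp hfX hg
    refine h1.trans (Finset.card_biUnion_le.trans (Finset.sum_le_sum fun p _ => ?_))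
    exact (Finset.card_union_le _ _).trans (Nat.add_le_add_left (Finset.card_union_le _ _) _)
  obtain ⟨p₀, hp₀, w₀, hw₀, hpw⟩ := Finset.one_lt_card.1
    (show 1 < e.card by rw [Q.uniform e he]; omega)
  -- Any `ℓ`-colouring of `Q` separates `p₀` from `w₀`; permuting colours moves their colours to `c
  -- y` and `j`.
  obtain ⟨ψ, hψ, hψp, hψw⟩ : ∃ ψ : VQ → Fin ℓ, Q.IsHom (complete r ℓ) ψ ∧ ψ p₀ = c y ∧
      ψ w₀ = j := by
    obtain ⟨φ, hφ⟩ := hQ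
    have hφ := isHom_complete_iff.1 hφ
    have hne : φ p₀ ≠ φ w₀ := fun h => hpw (hφ e he hp₀ hw₀ h)
    let σ : Equiv.Perm (Fin ℓ) := (Equiv.swap (φ p₀) (c y)).trans
      (Equiv.swap (Equiv.swap (φ p₀) (c y) (φ w₀)) j)
    refine ⟨fun q => σ (φ q), ?_, ?_, ?_⟩
    · exact isHom_complete_iff.2 fun e he a ha b hb hab => hφ e he ha hb (σ.injective hab)
    · simp only [σ, Equiv.trans_apply, Equiv.swap_apply_left]
      refine Equiv.swap_apply_of_ne_of_ne ?_ hj.symm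
      intro h
      rw [eq_comm, Equiv.swap_apply_eq_iff, Equiv.swap_apply_right] at h
      exact hne h.symm
    · simp [σ]
  have hG : ∀ p, ((G p).card : ℝ) +
      (if p = p₀ then (missing H M c y j).card * a ^ (Fintype.card VQ - 2) else 0) ≤
      ∑ ψ : VQ → Fin ℓ with Q.IsHom (complete r ℓ) ψ ∧ ψ p = c y,
        ∏ u ∈ Finset.univ.erase p, classSize c (ψ u) := by
    intro p
    refine le_trans ?_ (card_pi_eq_and_isHom_le Q c y p)
    split_ifs with hp
    · subst hp
      refine le_trans (add_le_add_left ?_ _)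
        (hψw ▸ card_good_add_missing_le Q H M c hψ hpw hψp ha hclass)
      refine Nat.cast_le.2 (Finset.card_le_card fun φ hφ => ?_)
      simp only [G, Finset.mem_filter, Finset.mem_univ, true_and] at hφ ⊢
      exact ⟨hφ.1, hφ.2.1, hφ.2.2 e he hp₀ w₀ hw₀ hpw.symm⟩
    · rw [add_zero]
      refine Nat.cast_le.2 (Finset.card_le_card fun φ hφ => ?_)
      simp only [G, Finset.mem_filter, Finset.mem_univ, true_and] at hφ ⊢
      exact ⟨hφ.1, hφ.2.1⟩
  have hGsum := Finset.sum_le_sum fun p (_ : p ∈ Finset.univ) => hG p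
  rw [Finset.sum_add_distrib, Finset.sum_ite_eq' Finset.univ p₀,
    if_pos (Finset.mem_univ p₀)] at hGsum
  have hJB : ∑ p, (((X p).card : ℝ) + (B p).card) ≤ Fintype.card VQ * (J + Fintype.card VQ *
        (Fintype.card VQ * (M * (Fintype.card V : ℝ) ^ (Fintype.card VQ - 2)))) := by
    rw [← nsmul_eq_mul, ← Finset.card_univ (α := VQ)]
    refine Finset.sum_le_card_nsmul _ _ _ fun p _ => add_le_add (hX p) ?_
    exact_mod_cast hBcard p
  have hdeg' : (Q.qDegree H y : ℝ) ≤ ∑ p, ((G p).card : ℝ) +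
      ∑ p, (((X p).card : ℝ) + (B p).card) := by
    rw [← Finset.sum_add_distrib]
    exact_mod_cast hdeg
  have hder : Q.lagrangeDeriv (c y) (classSize c) = ∑ p, ∑ ψ : VQ → Fin ℓ with
      Q.IsHom (complete r ℓ) ψ ∧ ψ p = c y, ∏ u ∈ Finset.univ.erase p, classSize c (ψ u) := rfl
  linarith

open Classical in
/-- The degree bound at a vertex other than the exceptional vertex `x`. -/
theorem qDegree_add_missing_le_of_ne (hr : 2 ≤ r) (Q : RGraph r VQ) (H : RGraph r V)
    (M : ℕ) {e : Finset VQ} (he : e ∈ Q.edges) (hQ : Q.IsPartite ℓ) (c : V → Fin ℓ) {x y : V}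
    (hxy : y ≠ x) (hc : ∀ E ∈ H.edges, x ∉ E → Set.InjOn c E)
    {a : ℝ} (ha : 0 ≤ a) (hclass : ∀ j, a ≤ classSize c j) {j : Fin ℓ} (hj : j ≠ c y) :
    (Q.qDegree H y : ℝ) + (missing H M c y j).card * a ^ (Fintype.card VQ - 2) ≤
      Q.lagrangeDeriv (c y) (classSize c) + Fintype.card VQ ^ 2 * (1 + Fintype.card VQ * M) *
        (Fintype.card V : ℝ) ^ (Fintype.card VQ - 2) := by
  -- The exceptional maps are those that also hit `x`.
  refine (qDegree_add_missing_le_of_exceptional hr Q H M he hQ c y ha hclass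
    (fun p => (Finset.univ.filter fun w => w ≠ p).biUnion fun w =>
      Finset.univ.filter fun φ : VQ → V => φ p = y ∧ φ w ∈ ({x} : Finset V))
    (Fintype.card VQ * (Fintype.card V : ℝ) ^ (Fintype.card VQ - 2)) ?_ ?_ hj).trans
      (le_of_eq (by ring))
  · intro p
    have h := Finset.card_biUnion_le_card_mul (Finset.univ.filter fun w => w ≠ p) (fun w =>
      Finset.univ.filter fun φ : VQ → V => φ p = y ∧ φ w ∈ ({x} : Finset V))
      (Fintype.card V ^ (Fintype.card VQ - 2)) fun w hw => by
        simpa using card_pi_mem_le (Finset.mem_filter.1 hw).2 y ({x} : Finset V)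
    have h2 := h.trans (Nat.mul_le_mul_right _ (Finset.card_le_univ _))
    exact_mod_cast h2
  · intro f hf p hp hfX _
    refine isHom_complete_iff.2 fun e he u hu u' hu' huu' => ?_
    have hx : x ∉ e.map f := by
      intro hx
      obtain ⟨w, hw, rfl⟩ := Finset.mem_map.1 hx
      refine hfX (Finset.mem_biUnion.2 ⟨w, ?_, by simp [hp]⟩)
      have : w ≠ p := by rintro rfl; exact hxy hp.symm
      simpa using this
    exact f.injective (hc _ (hf e he) hx (Finset.mem_coe.2 (Finset.mem_map_of_mem f hu))
      (Finset.mem_coe.2 (Finset.mem_map_of_mem f hu')) huu')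

open Classical in
/-- The degree bound at the exceptional vertex `x`, in terms of the number of its good neighbours
of its own colour. -/
theorem qDegree_add_missing_le_self (hr : 2 ≤ r) (Q : RGraph r VQ) (H : RGraph r V)
    (M : ℕ) {e : Finset VQ} (he : e ∈ Q.edges) (hQ : Q.IsPartite ℓ) (c : V → Fin ℓ) {x : V}
    (hc : ∀ E ∈ H.edges, ∀ u ∈ E, ∀ u' ∈ E, u ≠ x → u' ≠ x → c u = c u' → u = u')
    {a : ℝ} (ha : 0 ≤ a) (hclass : ∀ j, a ≤ classSize c j) {j : Fin ℓ} (hj : j ≠ c x) :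
    (Q.qDegree H x : ℝ) + (missing H M c x j).card * a ^ (Fintype.card VQ - 2) ≤
      Q.lagrangeDeriv (c x) (classSize c) + Fintype.card VQ ^ 2 *
        ((Finset.univ.filter fun z => c z = c x ∧ (H.goodGraph M).Adj x z).card +
          Fintype.card VQ * M) * (Fintype.card V : ℝ) ^ (Fintype.card VQ - 2) := by
  set N := Finset.univ.filter fun z => c z = c x ∧ (H.goodGraph M).Adj x z with hN
  -- The exceptional maps hit a good neighbour of `x` of the same colour. For any other map with
  -- only good pairs at `x`, an edge through `x` cannot repeat its colour.
  refine (qDegree_add_missing_le_of_exceptional hr Q H M he hQ c x ha hclass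
    (fun p => (Finset.univ.filter fun w => w ≠ p).biUnion fun w =>
      Finset.univ.filter fun φ : VQ → V => φ p = x ∧ φ w ∈ N)
    (Fintype.card VQ * (N.card * (Fintype.card V : ℝ) ^ (Fintype.card VQ - 2))) ?_ ?_ hj).trans
      (le_of_eq (by ring))
  · intro p
    have h := Finset.card_biUnion_le_card_mul (Finset.univ.filter fun w => w ≠ p) (fun w =>
      Finset.univ.filter fun φ : VQ → V => φ p = x ∧ φ w ∈ N)
      (N.card * Fintype.card V ^ (Fintype.card VQ - 2)) fun w hw =>
        card_pi_mem_le (Finset.mem_filter.1 hw).2 x N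
    have h2 := h.trans (Nat.mul_le_mul_right _ (Finset.card_le_univ _))
    exact_mod_cast h2
  · intro f hf p hp hfX hgood
    have hkey : ∀ e ∈ Q.edges, p ∈ e → ∀ w ∈ e, c (f w) = c x → w = p := by
      intro e he hpe w hw hcw
      by_contra hwp
      refine hfX (Finset.mem_biUnion.2 ⟨w, by simpa using hwp, ?_⟩)
      simp only [hN, Finset.mem_filter, Finset.mem_univ, true_and]
      exact ⟨hp, hcw, hgood e he hpe w hw hwp⟩
    refine isHom_complete_iff.2 fun e he u hu u' hu' huu' => ?_
    have huu' : c (f u) = c (f u') := huu'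
    by_cases h1 : f u = x
    · have hup : u = p := f.injective (h1.trans hp.symm)
      rw [h1] at huu'
      rw [hkey e he (hup ▸ hu) u' hu' huu'.symm, hup]
    · by_cases h2 : f u' = x
      · have hup : u' = p := f.injective (h2.trans hp.symm)
        rw [h2] at huu'
        rw [hkey e he (hup ▸ hu') u hu huu', hup]
      · exact f.injective (hc _ (hf e he) _ (Finset.mem_map_of_mem f hu) _
          (Finset.mem_map_of_mem f hu') h1 h2 huu')

end Counting

end RGraph

/-! ### From large minimum degree to an `ℓ`-colouring -/

namespace RGraph

theorem minQDegree_le {V : Type u} {r : ℕ} {VQ : Type v} (Q : RGraph r VQ) (H : RGraph r V) (y : V) :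
    Q.minQDegree H ≤ Q.qDegree H y :=
  ciInf_le (OrderBot.bddBelow _) y

section Extendability

variable {r ℓ : ℕ} {VQ : Type v} [Fintype VQ]

/-- If all vertices but `x` have nearly the largest possible derivative, then all colour classes
are large and all derivatives are nearly the largest possible ones. -/
theorem classSize_ge_and_lagrangeDeriv_le (Q : RGraph r VQ) (hq : 2 ≤ Fintype.card VQ) {c₀ : ℝ}
    (hc₀ : 0 < c₀)
    (hnear : ∀ x ∈ stdSimplex ℝ (Fin ℓ),
      Q.lagrangian (complete r ℓ) - c₀ ≤ Q.lagrangePoly (complete r ℓ) x → ∀ i, c₀ ≤ x i)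
    {V : Type u} [Fintype V] (c : V → Fin ℓ) (x : V) {ε : ℝ} (hε : 0 < ε) (hε1 : 3 * ε ≤ c₀)
    (hn1 : 1 ≤ ε * Fintype.card V) (hn2 : 2 ≤ c₀ * Fintype.card V)
    (hP : ∀ y, y ≠ x → (Q.lagrangian (complete r ℓ) - 2 * ε) * Fintype.card VQ *
      (Fintype.card V : ℝ) ^ (Fintype.card VQ - 1) ≤ Q.lagrangeDeriv (c y) (classSize c)) :
    (∀ j, c₀ * Fintype.card V ≤ classSize c j) ∧
    ∀ j, Q.lagrangeDeriv j (classSize c) ≤ (Q.lagrangian (complete r ℓ) + 6 * ε / c₀) *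
      Fintype.card VQ * (Fintype.card V : ℝ) ^ (Fintype.card VQ - 1) := by
  classical
  set q : ℝ := (Fintype.card VQ : ℝ) with hqdef
  set n : ℝ := (Fintype.card V : ℝ) with hndef
  set lam := Q.lagrangian (complete r ℓ) with hlam
  set N : ℝ := n ^ (Fintype.card VQ - 1) with hN
  have hn : 0 < n := by
    by_contra h
    have : ε * n ≤ 0 := mul_nonpos_of_nonneg_of_nonpos hε.le (not_lt.1 h)
    linarith
  have hq0 : 0 < q := by
    have : (2 : ℝ) ≤ q := by rw [hqdef]; exact_mod_cast hq
    linarith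
  have hNpos : 0 < N := pow_pos hn _
  have hNn : n ^ Fintype.card VQ = n * N := by
    rw [hN, ← pow_succ', Nat.sub_add_cancel (by omega)]
  have hlam1 : lam ≤ 1 := Q.lagrangian_le_one
  set A : ℝ := (lam - 2 * ε) * q * N with hA
  have hAq : A ≤ q * ε * n * N := by
    have h1 : (lam - 2 * ε) * q ≤ 1 * q := mul_le_mul_of_nonneg_right (by linarith) hq0.le
    have h2 : q * 1 ≤ q * (ε * n) := mul_le_mul_of_nonneg_left hn1 hq0.le
    exact mul_le_mul_of_nonneg_right (by linarith) hNpos.le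
  -- At `x` only nonnegativity of the derivative is known. The possible deficit `A` is at most `q *
  -- N`, which `1 ≤ ε * n` absorbs.
  have hDx : -(q * ε * n * N) ≤ Q.lagrangeDeriv (c x) (classSize c) - A := by
    have := Q.lagrangeDeriv_nonneg (c x) (x := classSize c) (fun j => classSize_nonneg c j)
    linarith
  have hsum : ∑ z, (Q.lagrangeDeriv (c z) (classSize c) - A) =
      q * Q.lagrangePoly (complete r ℓ) (classSize c) - n * A := by
    rw [Finset.sum_sub_distrib, ← sum_classSize_mul c fun j => Q.lagrangeDeriv j (classSize c),
      sum_mul_lagrangeDeriv, Finset.sum_const, Finset.card_univ, nsmul_eq_mul]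
  have hsplit := Finset.add_sum_erase Finset.univ
    (fun z => Q.lagrangeDeriv (c z) (classSize c) - A) (Finset.mem_univ x)
  have hnn : ∀ z ∈ Finset.univ.erase x, 0 ≤ Q.lagrangeDeriv (c z) (classSize c) - A :=
    fun z hz => sub_nonneg.2 (hP z (Finset.ne_of_mem_erase hz))
  have hrest := Finset.sum_nonneg hnn
  have hclass : ∀ j, c₀ * n ≤ classSize c j := by
    intro j
    have hpoly : (lam - 3 * ε) * (n * N) ≤ Q.lagrangePoly (complete r ℓ) (classSize c) := by
      have : q * ((lam - 3 * ε) * (n * N)) ≤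
          q * Q.lagrangePoly (complete r ℓ) (classSize c) := by
        have h : n * A = q * ((lam - 2 * ε) * (n * N)) := by rw [hA]; ring
        have h' : q * ((lam - 3 * ε) * (n * N)) =
          q * ((lam - 2 * ε) * (n * N)) - q * ε * n * N := by ring
        linarith
      exact le_of_mul_le_mul_left this hq0
    have hs : (fun i => n⁻¹ * classSize c i) ∈ stdSimplex ℝ (Fin ℓ) := by
      refine ⟨fun i => mul_nonneg (inv_nonneg.2 hn.le) (classSize_nonneg c i), ?_⟩
      rw [← Finset.mul_sum, sum_classSize, inv_mul_cancel₀ hn.ne']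
    have h := hnear _ hs (by
      rw [lagrangePoly_smul, inv_pow, hNn, inv_mul_eq_div, le_div_iff₀ (by positivity)]
      refine le_trans ?_ hpoly
      exact mul_le_mul_of_nonneg_right (by linarith) (by positivity)) j
    rwa [inv_mul_eq_div, le_div_iff₀ hn] at h
  refine ⟨hclass, fun j => ?_⟩
  have hle := Q.lagrangePoly_le_lagrangian_mul (classSize c) (fun j => classSize_nonneg c j) hn
    (sum_classSize c)
  rw [hNn] at hle
  have hrest' : ∑ z ∈ Finset.univ.erase x, (Q.lagrangeDeriv (c z) (classSize c) - A) ≤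
      3 * q * ε * n * N := by
    have h := mul_le_mul_of_nonneg_left hle hq0.le
    have h' : q * (lam * (n * N)) - n * A = 2 * q * ε * n * N := by rw [hA]; ring
    linarith
  by_contra hcon
  push Not at hcon
  have hgt : 6 * ε / c₀ * q * N < Q.lagrangeDeriv j (classSize c) - A := by
    have h1 : (lam + 6 * ε / c₀) * q * N = A + 2 * ε * q * N + 6 * ε / c₀ * q * N := by
      rw [hA]; ring
    have h2 : 0 ≤ 2 * ε * q * N := by positivity
    linarith
  -- The derivative depends only on the colour, so a whole class shares the same excess over `A`.
  -- The class has at least `c₀ * n / 2` vertices besides `x`, and the total excess is at most `3 *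
  -- q * ε * n * N`; this explains `6 * ε / c₀`.
  have hj : ((Finset.univ.erase x).filter fun z => c z = j).card •
      (Q.lagrangeDeriv j (classSize c) - A) ≤
      ∑ z ∈ Finset.univ.erase x, (Q.lagrangeDeriv (c z) (classSize c) - A) := by
    refine le_trans (le_of_eq ?_) (Finset.sum_le_sum_of_subset_of_nonneg
      (Finset.filter_subset (fun z => c z = j) _) fun z hz _ => hnn z hz)
    rw [← Finset.sum_const]
    exact Finset.sum_congr rfl fun z hz => by rw [(Finset.mem_filter.1 hz).2]
  have hcard : c₀ * n / 2 ≤ (((Finset.univ.erase x).filter fun z => c z = j).card : ℝ) := by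
    have h1 : classSize c j ≤ (((Finset.univ.erase x).filter fun z => c z = j).card : ℝ) + 1 := by
      have : (Finset.univ.filter fun z => c z = j).card ≤
          ((Finset.univ.erase x).filter fun z => c z = j).card + 1 := by
        rw [Finset.filter_erase]
        exact Nat.sub_le_iff_le_add.1 Finset.pred_card_le_card_erase
      unfold classSize
      exact_mod_cast this
    have := hclass j
    linarith
  rw [nsmul_eq_mul] at hj
  have hpos : 0 < Q.lagrangeDeriv j (classSize c) - A :=
    lt_of_le_of_lt (by positivity) hgt
  have h1 := mul_le_mul_of_nonneg_right hcard hpos.le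
  have h2 := mul_lt_mul_of_pos_left hgt (show 0 < c₀ * n / 2 by positivity)
  have h3 : c₀ * n / 2 * (6 * ε / c₀ * q * N) = 3 * q * ε * n * N := by
    field_simp
    ring
  linarith

/-- In an `r`-graph of large minimum `Q`-degree that is `ℓ`-partite up to one vertex `x`, the
colour classes are large and every vertex except possibly `x` has few missing neighbours. -/
theorem exists_eps_missing_le (hr : 2 ≤ r) (hℓ : 2 ≤ ℓ) (Q : RGraph r VQ)
    (hq : 2 ≤ Fintype.card VQ) {e : Finset VQ} (he : e ∈ Q.edges) (hQ : Q.IsPartite ℓ) {c₀ : ℝ}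
    (hc₀ : 0 < c₀)
    (hnear : ∀ x ∈ stdSimplex ℝ (Fin ℓ),
      Q.lagrangian (complete r ℓ) - c₀ ≤ Q.lagrangePoly (complete r ℓ) x → ∀ i, c₀ ≤ x i)
    (M : ℕ) {δ : ℝ} (hδ : 0 < δ) :
    ∃ ε : ℝ, 0 < ε ∧ ε ≤ δ ∧ ∃ N₀ : ℕ, ∀ (V : Type u) [Fintype V], N₀ ≤ Fintype.card V →
      ∀ (H : RGraph r V) (c : V → Fin ℓ) (x : V), (∀ E ∈ H.edges, x ∉ E → Set.InjOn c E) →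
      (∀ y, (Q.lagrangian (complete r ℓ) - ε) * Fintype.card VQ *
        (Fintype.card V : ℝ) ^ (Fintype.card VQ - 1) ≤ Q.qDegree H y) →
      (∀ j, c₀ * Fintype.card V ≤ classSize c j) ∧
      (∀ j, Q.lagrangeDeriv j (classSize c) ≤ (Q.lagrangian (complete r ℓ) + δ) *
        Fintype.card VQ * (Fintype.card V : ℝ) ^ (Fintype.card VQ - 1)) ∧
      ∀ y, y ≠ x → ∀ j, j ≠ c y → ((missing H M c y j).card : ℝ) ≤ δ * Fintype.card V := by
  set q : ℝ := (Fintype.card VQ : ℝ) with hqdef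
  set lam := Q.lagrangian (complete r ℓ) with hlam
  have hq0 : 0 < q := by
    have : (2 : ℝ) ≤ q := by rw [hqdef]; exact_mod_cast hq
    linarith
  set a₀ : ℝ := c₀ ^ (Fintype.card VQ - 2) with ha₀
  have ha₀pos : 0 < a₀ := pow_pos hc₀ _
  set C : ℝ := q ^ 2 * (1 + q * M) with hC
  have hCpos : 0 ≤ C := by positivity
  set K : ℝ := (6 / c₀ + 2) * q / a₀ with hK
  have hKpos : 0 < K := by positivity
  set ε : ℝ := min δ (min (c₀ / 3) (min (δ / K) (δ * c₀ / 6))) with hεdef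
  have hε : 0 < ε := by simp only [hεdef, lt_min_iff]; refine ⟨hδ, ?_, ?_, ?_⟩ <;> positivity
  have hε1 : ε ≤ δ := min_le_left _ _
  have hε2 : ε ≤ c₀ / 3 := (min_le_right _ _).trans (min_le_left _ _)
  have hε3 : ε ≤ δ / K := (min_le_right _ _).trans ((min_le_right _ _).trans (min_le_left _ _))
  have hε4 : ε ≤ δ * c₀ / 6 :=
    (min_le_right _ _).trans ((min_le_right _ _).trans (min_le_right _ _))
  refine ⟨ε, hε, hε1, ⌈C / (q * ε) + 1 / ε + 2 / c₀⌉₊, ?_⟩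
  intro V _ hN₀ H c x hc hdeg
  set n : ℝ := (Fintype.card V : ℝ) with hndef
  have hN₀' : C / (q * ε) + 1 / ε + 2 / c₀ ≤ n := (Nat.le_ceil _).trans (Nat.cast_le.2 hN₀)
  have t1 : 0 ≤ C / (q * ε) := by positivity
  have t2 : 0 < 1 / ε := by positivity
  have t3 : 0 < 2 / c₀ := by positivity
  have hn : 0 < n := by linarith
  have hnC : C ≤ q * ε * n := by
    have : C / (q * ε) ≤ n := by linarith
    rw [div_le_iff₀ (by positivity)] at this
    linarith
  have hn1 : 1 ≤ ε * n := by
    have : 1 / ε ≤ n := by linarith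
    rw [div_le_iff₀ hε] at this
    linarith
  have hn2 : 2 ≤ c₀ * n := by
    have : 2 / c₀ ≤ n := by linarith
    rw [div_le_iff₀ hc₀] at this
    linarith
  set m : ℝ := n ^ (Fintype.card VQ - 2) with hm
  have hmpos : 0 < m := pow_pos hn _
  have hNm : n ^ (Fintype.card VQ - 1) = n * m := by
    rw [hm, ← pow_succ']
    congr 1
    omega
  have hCm : C * m ≤ q * ε * (n * m) := by
    have := mul_le_mul_of_nonneg_right hnC hmpos.le
    linarith
  have : Nontrivial (Fin ℓ) := Fin.nontrivial_iff_two_le.2 hℓ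
  have hP : ∀ y, y ≠ x → (lam - 2 * ε) * q * n ^ (Fintype.card VQ - 1) ≤
      Q.lagrangeDeriv (c y) (classSize c) := by
    intro y hy
    obtain ⟨j, hj⟩ := exists_ne (c y)
    -- No lower bound on the class sizes is available yet, so `a = 0` and the missing term is simply
    -- dropped. The bound is used again with `a = c₀ * n` once the classes are known to be large.
    have h := qDegree_add_missing_le_of_ne hr Q H M he hQ c hy hc le_rfl
      (fun j => classSize_nonneg c j) hj
    have h0 : 0 ≤ ((missing H M c y j).card : ℝ) * 0 ^ (Fintype.card VQ - 2) := by positivity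
    have h1 := hdeg y
    rw [hNm] at h1 ⊢
    have h2 : (lam - 2 * ε) * q * (n * m) = (lam - ε) * q * (n * m) - q * ε * (n * m) := by ring
    linarith
  obtain ⟨hclass, hder⟩ := classSize_ge_and_lagrangeDeriv_le Q hq hc₀ hnear c x hε (by linarith)
    hn1 hn2 hP
  refine ⟨hclass, fun j => (hder j).trans ?_, fun y hy j hj => ?_⟩
  · have : 6 * ε / c₀ ≤ δ := by
      rw [div_le_iff₀ hc₀]
      linarith
    gcongr
  · have h := qDegree_add_missing_le_of_ne hr Q H M he hQ c hy hc (by positivity) hclass hj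
    have h1 := hdeg y
    have h2 := hder (c y)
    rw [mul_pow] at h
    rw [hNm] at h1 h2
    have h3 : ((missing H M c y j).card : ℝ) * (a₀ * m) ≤ (6 / c₀ + 2) * q * ε * n * m := by
      have e1 : (lam + 6 * ε / c₀) * q * (n * m) - (lam - ε) * q * (n * m) + q * ε * (n * m) =
        (6 / c₀ + 2) * q * ε * n * m := by ring
      linarith
    have h4 : (6 / c₀ + 2) * q * ε * n * m = (K * ε * n) * (a₀ * m) := by
      rw [hK]
      field_simp
    rw [h4] at h3
    have h5 := le_of_mul_le_mul_right h3 (by positivity)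
    refine h5.trans (mul_le_mul_of_nonneg_right ?_ hn.le)
    rw [le_div_iff₀ hKpos] at hε3
    linarith

open Classical in
theorem classSize_sub_missing_le {V : Type u} [Fintype V] (H : RGraph r V) (M : ℕ)
    (c : V → Fin ℓ) (y y' : V) (j : Fin ℓ) :
    classSize c j - (missing H M c y j).card - (missing H M c y' j).card ≤
      ((Finset.univ.filter fun u => c u = j ∧
        (H.goodGraph M).Adj y u ∧ (H.goodGraph M).Adj y' u).card : ℝ) := by
  have h : (Finset.univ.filter fun z => c z = j).card ≤
      (Finset.univ.filter fun u => c u = j ∧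
        (H.goodGraph M).Adj y u ∧ (H.goodGraph M).Adj y' u).card +
      ((missing H M c y j).card + (missing H M c y' j).card) := by
    refine (Finset.card_le_card ?_).trans ((Finset.card_union_le _ _).trans
      (Nat.add_le_add_left (Finset.card_union_le _ _) _))
    intro z hz
    simp only [missing, Finset.mem_union, Finset.mem_filter, Finset.mem_univ, true_and] at hz ⊢
    tauto
  have h' : classSize c j ≤ ((Finset.univ.filter fun u => c u = j ∧
        (H.goodGraph M).Adj y u ∧ (H.goodGraph M).Adj y' u).card : ℝ) +
      ((missing H M c y j).card + (missing H M c y' j).card) := by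
    unfold classSize
    exact_mod_cast h
  linarith

open Classical in
theorem card_adj_sub_missing_le {V : Type u} [Fintype V] (H : RGraph r V) (M : ℕ)
    (c : V → Fin ℓ) (y y' : V) (j : Fin ℓ) :
    ((Finset.univ.filter fun u => c u = j ∧ (H.goodGraph M).Adj y u).card : ℝ) -
        (missing H M c y' j).card ≤
      ((Finset.univ.filter fun u => c u = j ∧
        (H.goodGraph M).Adj y u ∧ (H.goodGraph M).Adj y' u).card : ℝ) := by
  have h : (Finset.univ.filter fun u => c u = j ∧ (H.goodGraph M).Adj y u).card ≤
      (Finset.univ.filter fun u => c u = j ∧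
        (H.goodGraph M).Adj y u ∧ (H.goodGraph M).Adj y' u).card +
      (missing H M c y' j).card := by
    refine (Finset.card_le_card ?_).trans (Finset.card_union_le _ _)
    intro z hz
    simp only [missing, Finset.mem_union, Finset.mem_filter, Finset.mem_univ, true_and] at hz ⊢
    tauto
  have h' := (Nat.cast_le (α := ℝ)).2 h
  push_cast at h'
  linarith

open Classical in
/-- An `r`-graph of large minimum `Q`-degree without a copy of the expansion of an edge-critical
`(ℓ + 1)`-chromatic graph is `ℓ`-partite as soon as it is so up to one vertex. -/
theorem exists_eps_isPartite (hr : 2 ≤ r) (hℓ : 2 ≤ ℓ) (Q : RGraph r VQ) {e : Finset VQ}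
    (he : e ∈ Q.edges) (hQ : Q.IsPartite ℓ) {VF : Type w} [Fintype VF] {F : SimpleGraph VF}
    (hF : EdgeCritical F) (hχ : F.chromaticNumber = ((ℓ + 1 : ℕ) : ℕ∞)) :
    ∃ ε : ℝ, 0 < ε ∧ ∃ N₀ : ℕ, ∀ (V : Type u) [Fintype V], N₀ ≤ Fintype.card V →
      ∀ (H : RGraph r V) (c : V → Fin ℓ) (x : V), (expansion hr F).Free H →
      (∀ E ∈ H.edges, x ∉ E → Set.InjOn c E) →
      (∀ y, (Q.lagrangian (complete r ℓ) - ε) * Fintype.card VQ *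
        (Fintype.card V : ℝ) ^ (Fintype.card VQ - 1) ≤ Q.qDegree H y) →
      H.IsPartite ℓ := by
  have hq : 2 ≤ Fintype.card VQ := hr.trans (Q.uniform e he ▸ Finset.card_le_univ e)
  obtain ⟨c₀, hc₀, hnear⟩ := Q.exists_coord_ge_of_near_lagrangian hr (by omega) he hQ
  set q : ℝ := (Fintype.card VQ : ℝ) with hqdef
  set lam := Q.lagrangian (complete r ℓ) with hlam
  set f : ℝ := (Fintype.card VF : ℝ) with hf
  have hf0 : 0 ≤ f := Nat.cast_nonneg _
  set M : ℕ := Fintype.card VF + (Fintype.card F.edgeSet + 1) * r with hM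
  have hq0 : 0 < q := by
    have : (2 : ℝ) ≤ q := by rw [hqdef]; exact_mod_cast hq
    linarith
  set a₀ : ℝ := c₀ ^ (Fintype.card VQ - 2) with ha₀
  have ha₀pos : 0 < a₀ := pow_pos hc₀ _
  -- Three thresholds, as fractions of `n`: `τ` is what the greedy embedding tolerates as missing
  -- inside classes of size `c₀ * n`; `η` bounds the good neighbours of `x` of its own colour, small
  -- enough to force at most `τ * n` missing at `x`; `δ` is what the embedding tolerates inside sets
  -- of size `η * n`.
  set τ : ℝ := c₀ / (2 * (f + 2)) with hτ
  have hτpos : 0 < τ := by positivity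
  have hτc : (f + 2) * τ = c₀ / 2 := by
    rw [hτ]
    field_simp
  set η : ℝ := min c₀ (a₀ * τ / (4 * q ^ 2)) with hη
  have hηpos : 0 < η := by simp only [hη, lt_min_iff]; constructor <;> positivity
  have hηc : η ≤ c₀ := min_le_left _ _
  have hητ : 2 * q ^ 2 * η ≤ a₀ * τ / 2 := by
    have : η ≤ a₀ * τ / (4 * q ^ 2) := min_le_right _ _
    rw [le_div_iff₀ (by positivity)] at this
    linarith
  set δ : ℝ := min τ (min (η / (2 * (f + 1))) (a₀ * τ / (4 * q))) with hδ
  have hδpos : 0 < δ := by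
    simp only [hδ, lt_min_iff]
    refine ⟨hτpos, ?_, ?_⟩ <;> positivity
  have hδτ : δ ≤ τ := min_le_left _ _
  have hδη : (f + 1) * δ ≤ η / 2 := by
    have : δ ≤ η / (2 * (f + 1)) := (min_le_right _ _).trans (min_le_left _ _)
    rw [le_div_iff₀ (by positivity)] at this
    linarith
  have hδa : 2 * q * δ ≤ a₀ * τ / 2 := by
    have : δ ≤ a₀ * τ / (4 * q) := (min_le_right _ _).trans (min_le_right _ _)
    rw [le_div_iff₀ (by positivity)] at this
    linarith
  obtain ⟨ε, hε, hεδ, N₁, hN₁⟩ := exists_eps_missing_le.{u} hr hℓ Q hq he hQ hc₀ hnear M hδpos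
  refine ⟨ε, hε, max N₁ (⌈2 * (f + r) / η + q * M / η⌉₊ + 1), ?_⟩
  intro V _ hN₀ H c x hfree hc hdeg
  set n : ℝ := (Fintype.card V : ℝ) with hndef
  have hN₀' : 2 * (f + r) / η + q * M / η + 1 ≤ n := by
    have h1 : ⌈2 * (f + r) / η + q * M / η⌉₊ + 1 ≤ Fintype.card V :=
      (le_max_right _ _).trans hN₀
    have h2 := (Nat.cast_le (α := ℝ)).2 h1
    push_cast at h2
    have h3 := Nat.le_ceil (2 * (f + r) / η + q * M / η)
    linarith
  have t1 : 0 ≤ 2 * (f + r) / η := by positivity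
  have t2 : 0 ≤ q * M / η := by positivity
  have hn : 0 < n := by linarith
  have hnη : f + r < η * n / 2 := by
    have : 2 * (f + r) / η < n := by linarith
    rw [div_lt_iff₀ hηpos] at this
    linarith
  have hnM : q * M ≤ η * n := by
    have : q * M / η ≤ n := by linarith
    rw [div_le_iff₀ hηpos] at this
    linarith
  have hηcn : η * n ≤ c₀ * n := mul_le_mul_of_nonneg_right hηc hn.le
  have hδτn : δ * n ≤ τ * n := mul_le_mul_of_nonneg_right hδτ hn.le
  have hT : f * (τ * n + 1) + r < c₀ * n - 2 * (τ * n) := by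
    have : (f + 2) * τ * n = c₀ / 2 * n := by rw [hτc]
    linarith
  have hT' : f * (δ * n + 1) + r < η * n - δ * n := by
    have := mul_le_mul_of_nonneg_right hδη hn.le
    linarith
  have hτn0 : 0 ≤ τ * n := by positivity
  have hδn0 : 0 ≤ δ * n := by positivity
  -- Few missing neighbours are required only at `u`, `u'` and outside `E`, so that a third vertex
  -- `x ∈ E` with unknown neighbourhood does no harm.
  have rainbow : ∀ c : V → Fin ℓ, (∀ j, c₀ * n ≤ classSize c j) →
      ∀ E ∈ H.edges, ∀ u ∈ E, ∀ u' ∈ E,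
      (∀ z, z = u ∨ z = u' ∨ z ∉ E → ∀ j, j ≠ c z →
        ((missing H M c z j).card : ℝ) ≤ τ * n) → c u = c u' → u = u' := by
    intro c hclass E hE u hu u' hu' hmiss huu'
    by_contra hne
    refine not_free_expansion_of_edge hr hF hχ H hM.ge c (τ * n) (c₀ * n - 2 * (τ * n)) hτn0 hT
      E hE hu hu' hne (c u) (fun z hz => hmiss z (Or.inr (Or.inr hz))) ?_ ?_ hfree
    · refine le_trans ?_ (hclass (c u))
      linarith
    · intro j hj
      refine le_trans ?_ (classSize_sub_missing_le H M c u u' j)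
      have h1 := hclass j
      have h2 := hmiss u (Or.inl rfl) j hj
      have h3 := hmiss u' (Or.inr (Or.inl rfl)) j (huu' ▸ hj)
      linarith
  obtain ⟨hclass, -, hmiss⟩ := hN₁ V ((le_max_left _ _).trans hN₀) H c x hc hdeg
  have hoff : ∀ E ∈ H.edges, ∀ u ∈ E, ∀ u' ∈ E, u ≠ x → u' ≠ x → c u = c u' → u = u' := by
    intro E hE u hu u' hu' hux hux' huu'
    by_cases hx : x ∈ E
    · refine rainbow c hclass E hE u hu u' hu' (fun z hz j hj => ?_) huu'
      refine (hmiss z ?_ j hj).trans hδτn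
      rcases hz with rfl | rfl | hz
      · exact hux
      · exact hux'
      · rintro rfl
        exact hz hx
    · exact hc E hE hx hu hu' huu'
  -- Otherwise the critical edge goes on `x` and a good neighbour `y`. The current colour of `x` is
  -- irrelevant here: `x` plays a vertex of colour `c y`, as it has many good neighbours in every
  -- class.
  obtain ⟨i, hi⟩ : ∃ i, ((Finset.univ.filter fun u => c u = i ∧
      (H.goodGraph M).Adj x u).card : ℝ) < η * n := by
    by_contra! hall
    obtain ⟨y, hy⟩ : (Finset.univ.filter fun u => c u = (⟨0, by omega⟩ : Fin ℓ) ∧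
        (H.goodGraph M).Adj x u).Nonempty := by
      rw [← Finset.card_pos]
      have := (mul_pos hηpos hn).trans_le (hall ⟨0, by omega⟩)
      exact_mod_cast this
    have hxy := (Finset.mem_filter.1 hy).2.2
    obtain ⟨E, hE, hxE, hyE, -⟩ := hxy.2 ∅ (by simp) (by simp) (by simp)
    refine not_free_expansion_of_edge hr hF hχ H hM.ge c (δ * n) (η * n - δ * n) hδn0 hT'
      E hE hxE hyE hxy.1 (c y) (fun z hz => hmiss z ?_) ?_ ?_ hfree
    · rintro rfl
      exact hz hxE
    · refine le_trans ?_ (hclass (c y))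
      linarith
    · intro j hj
      refine le_trans ?_ (card_adj_sub_missing_le H M c x y j)
      have h1 := hall j
      have h2 := hmiss y hxy.1.symm j hj
      linarith
  set c' : V → Fin ℓ := Function.update c x i with hc'
  have hcx : c' x = i := Function.update_self _ _ _
  have hcne : ∀ z, z ≠ x → c' z = c z := fun z hz => Function.update_of_ne hz _ _
  have hoff' : ∀ E ∈ H.edges, ∀ u ∈ E, ∀ u' ∈ E, u ≠ x → u' ≠ x → c' u = c' u' → u = u' := by
    intro E hE u hu u' hu' hux hux' huu'
    rw [hcne u hux, hcne u' hux'] at huu'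
    exact hoff E hE u hu u' hu' hux hux' huu'
  -- Recolouring `x` changes the class sizes, so the estimates are derived anew for `c'`.
  obtain ⟨hclass', hder', hmiss'⟩ := hN₁ V ((le_max_left _ _).trans hN₀) H c' x
    (fun E hE hx u hu u' hu' => hoff' E hE u hu u' hu' (by rintro rfl; exact hx hu)
      (by rintro rfl; exact hx hu')) hdeg
  have hown : ((Finset.univ.filter fun z => c' z = c' x ∧ (H.goodGraph M).Adj x z).card : ℝ) <
      η * n := by
    refine lt_of_le_of_lt (Nat.cast_le.2 (Finset.card_le_card fun z hz => ?_)) hi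
    simp only [Finset.mem_filter, Finset.mem_univ, true_and] at hz ⊢
    rw [hcx, hcne z hz.2.1.symm] at hz
    exact hz
  -- With few good neighbours of its own colour, `x` obeys the same derivative bound as the other
  -- vertices up to a term of order `η`, so the large degree limits its missing neighbours.
  have hmissx : ∀ j, j ≠ c' x → ((missing H M c' x j).card : ℝ) ≤ τ * n := by
    intro j hj
    have h := qDegree_add_missing_le_self hr Q H M he hQ c' hoff' (by positivity) hclass' hj
    set m : ℝ := n ^ (Fintype.card VQ - 2) with hm
    have hmpos : 0 < m := pow_pos hn _
    have hNm : n ^ (Fintype.card VQ - 1) = n * m := by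
      rw [hm, ← pow_succ']
      congr 1
      omega
    have h1 := hdeg x
    have h2 := hder' (c' x)
    rw [mul_pow] at h
    rw [hNm] at h1 h2
    have h3 : q ^ 2 * ((Finset.univ.filter fun z => c' z = c' x ∧
        (H.goodGraph M).Adj x z).card + q * M) * m ≤ q ^ 2 * (η * n + η * n) * m := by
      gcongr
    have h4 : ε * q * (n * m) ≤ δ * q * (n * m) := by gcongr
    have h5 : (2 * q * δ + 2 * q ^ 2 * η) * (n * m) ≤ (a₀ * τ / 2 + a₀ * τ / 2) * (n * m) := by
      gcongr
    have h6 : ((missing H M c' x j).card : ℝ) * (a₀ * m) ≤ τ * n * (a₀ * m) := by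
      linarith
    exact le_of_mul_le_mul_right h6 (by positivity)
  refine ⟨c', isHom_complete_iff.2 fun E hE u hu u' hu' huu' => ?_⟩
  refine rainbow c' hclass' E hE u hu u' hu' (fun z _ j hj => ?_) huu'
  by_cases hz : z = x
  · subst hz
    exact hmissx j hj
  · exact (hmiss' z hz j hj).trans hδτn

theorem exists_coloring_of_deleteVertex {V : Type u} (hℓ : 0 < ℓ) {H : RGraph r V} {x : V}
    (h : (H.deleteVertex x).IsPartite ℓ) :
    ∃ c : V → Fin ℓ, ∀ E ∈ H.edges, x ∉ E → Set.InjOn c E := by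
  classical
  obtain ⟨φ, hφ⟩ := h
  have hφ := isHom_complete_iff.1 hφ
  -- The colour of `x` is a dummy value, since only edges avoiding `x` are constrained.
  refine ⟨fun z => if hz : z ≠ x then φ ⟨z, hz⟩ else ⟨0, hℓ⟩, fun E hE hx u hu u' hu' huu' => ?_⟩
  have hne : ∀ z ∈ E, z ≠ x := by
    rintro z hz rfl
    exact hx hz
  have hmem : E.subtype (fun z => z ≠ x) ∈ (H.deleteVertex x).edges := by
    change (E.subtype (fun z => z ≠ x)).map (Function.Embedding.subtype _) ∈ H.edges
    rwa [Finset.subtype_map_of_mem hne]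
  simp only [dif_pos (hne u hu), dif_pos (hne u' hu')] at huu'
  exact congrArg Subtype.val (hφ _ hmem (x₁ := ⟨u, hne u hu⟩) (x₂ := ⟨u', hne u' hu'⟩)
    (by simpa using hu) (by simpa using hu') huu')

end Extendability

end RGraph

/-! ### The proposition -/

theorem mainTheorem8 {ℓ k r : ℕ} (hkℓ : k ≤ ℓ) (hrk : r ≤ k) (hr : 2 ≤ r)
    {VQ : Type v} [Fintype VQ] (Q : RGraph r VQ) (hQ : Q.chromaticNumber = k)
    {VF : Type w} [Fintype VF] (F : SimpleGraph VF) (hF : EdgeCritical F)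
    (hχF : F.chromaticNumber = ((ℓ + 1 : ℕ) : ℕ∞)) :
    (∃ ε : ℝ, 0 < ε ∧ ∃ N₀ : ℕ, ∀ n : ℕ, N₀ ≤ n →
      ∀ (V : Type u) [Fintype V], Fintype.card V = n →
      ∀ H : RGraph r V, (RGraph.expansion hr F).Free H →
        (Q.lagrangian (RGraph.complete r ℓ) - ε) * (Fintype.card VQ : ℝ)
            * (n : ℝ) ^ (Fintype.card VQ - 1) ≤ (Q.minQDegree H : ℝ) →
        ∀ x : V, (H.deleteVertex x).IsPartite ℓ → H.IsPartite ℓ) ∧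
    (Q.HasInjDensity (RGraph.expansion hr F) (Q.lagrangian (RGraph.complete r ℓ)) →
      Q.VertexExtendable (RGraph.expansion hr F)
        (fun {X : Type u} (H : RGraph r X) => H.IsPartite ℓ)) := by
  have hpart : Q.IsPartite ℓ :=
    RGraph.isPartite_of_chromaticNumber_le (by omega) (hQ.le.trans hkℓ)
  obtain ⟨e, he⟩ := RGraph.exists_edge_of_two_le_chromaticNumber (Q := Q) (by omega)
  have hq : 2 ≤ Fintype.card VQ := hr.trans (Q.uniform e he ▸ Finset.card_le_univ e)
  obtain ⟨ε, hε, N₀, hN₀⟩ := RGraph.exists_eps_isPartite.{u} hr (by omega) Q he hpart hF hχF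
  have main : ∀ (V : Type u) [Fintype V], N₀ ≤ Fintype.card V →
      ∀ H : RGraph r V, (RGraph.expansion hr F).Free H →
        (Q.lagrangian (RGraph.complete r ℓ) - ε) * (Fintype.card VQ : ℝ)
            * (Fintype.card V : ℝ) ^ (Fintype.card VQ - 1) ≤ (Q.minQDegree H : ℝ) →
        ∀ x : V, (H.deleteVertex x).IsPartite ℓ → H.IsPartite ℓ := by
    intro V _ hV H hfree hdeg x hx
    obtain ⟨c, hc⟩ := RGraph.exists_coloring_of_deleteVertex (by omega) hx
    exact hN₀ V hV H c x hfree hc fun y => hdeg.trans (Nat.cast_le.2 (Q.minQDegree_le H y))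
  refine ⟨⟨ε, hε, N₀, fun n hn V _ hV => ?_⟩, fun hdens => ?_⟩
  · subst hV
    exact main V hn
  · set lam := Q.lagrangian (RGraph.complete r ℓ) with hlam
    have hlam1 : lam ≤ 1 := Q.lagrangian_le_one
    have hev : ∀ᶠ n : ℕ in atTop, lam - ε / 2 <
        (RGraph.injMax n Q (RGraph.expansion hr F) : ℝ) / (n : ℝ) ^ Fintype.card VQ :=
      hdens.eventually (lt_mem_nhds (by linarith))
    obtain ⟨N₁, hN₁⟩ := eventually_atTop.1 hev
    -- Half of `ε` pays for the convergence of the density and half for the factor `1 - ε'`, using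
    -- `lam ≤ 1`; the cap at `1` keeps that factor nonnegative.
    refine ⟨min (ε / 2) 1, by positivity, max (max N₀ N₁) 1, ?_⟩
    rintro X _ hX H hfree hdeg ⟨x, hx⟩
    refine main X ((le_max_left _ _).trans ((le_max_left _ _).trans hX)) H hfree ?_ x hx
    refine le_trans ?_ hdeg
    have hn : (0 : ℝ) < Fintype.card X := by
      have : 1 ≤ Fintype.card X := (le_max_right _ _).trans hX
      exact_mod_cast this
    have hinj := hN₁ _ ((le_max_right _ _).trans ((le_max_left _ _).trans hX))
    set n : ℝ := (Fintype.card X : ℝ) with hndef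
    set I : ℝ := (RGraph.injMax (Fintype.card X) Q (RGraph.expansion hr F) : ℝ) with hI
    set q : ℝ := (Fintype.card VQ : ℝ) with hqdef
    have hq0 : 0 < q := by
      have : (2 : ℝ) ≤ q := by rw [hqdef]; exact_mod_cast hq
      linarith
    rw [lt_div_iff₀ (by positivity)] at hinj
    set N : ℝ := n ^ (Fintype.card VQ - 1) with hN
    have hNpos : 0 < N := pow_pos hn _
    have hNn : n ^ Fintype.card VQ = N * n := by
      rw [hN, ← pow_succ, Nat.sub_add_cancel (by omega)]
    rw [hNn] at hinj
    have h1 : (lam - ε / 2) * N ≤ I / n := by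
      rw [le_div_iff₀ hn]
      linarith
    set ε' : ℝ := min (ε / 2) 1 with hε'
    have he1 : ε' ≤ ε / 2 := min_le_left _ _
    have he2 : ε' ≤ 1 := min_le_right _ _
    have he0 : 0 < ε' := by positivity
    have h2 : lam - ε ≤ (1 - ε') * (lam - ε / 2) := by nlinarith
    calc (lam - ε) * q * N ≤ (1 - ε') * (lam - ε / 2) * q * N := by gcongr
      _ = (1 - ε') * (q * ((lam - ε / 2) * N)) := by ring
      _ ≤ (1 - ε') * (q * (I / n)) := by
        have : 0 ≤ 1 - ε' := by linarith
        gcongr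
      _ = (1 - ε') * (q * I / n) := by ring
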